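/- Let $(A,\mathfrak m)$ be a (commutative) local ring and $J_1,\dots,J_s$ ideals of $A$. The mixed multiplicities $e_{\mathbf i}(\mathfrak m|J_1,\dots,J_s)$ are defined as follows: if $P$ is the polynomial with $$P(u,v_1,\dots,v_s)=\dim_{A/\mathfrak m}\ \mathfrak m^uJ_1^{v_1}\cdots J_s^{v_s}/\mathfrak m^{u+1}J_1^{v_1}\cdots J_s^{v_s}\qquad\text{for all large }u,v_1,\dots,v_s,$$ and $P$ has total degree $n$, then $$P(u,v_1,\dots,v_s)=\sum_{|\mathbf i|=n}\frac{e_{\mathbf i}(\mathfrak m|J_1,\dots,J_s)}{i_0!\,i_1!\cdots i_s!}\,u^{i_0}v_1^{i_1}\cdots v_s^{i_s}+(\text{lower degree terms}).$$ Let $A=\mathbb C\{x,y,z\}$ be the ring of convergent power series in three variables, a Noetherian local ring of dimension $3$, and let $$J_1=(xy^2,\;y^3z,\;xz),\qquad J_2=(xy^2,\;y^3z,\;xz^2).$$ Then $\operatorname{ht}(J_1)=\operatorname{ht}(J_2)=2$, and (the polynomials above exist, have total degree $2$, and) $$e_{(0,1,1)}(\mathfrak m|J_1,J_1)=1,\qquad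 e_{(0,1,1)}(\mathfrak m|J_1,J_2)=1,\qquad e_{(0,1,1)}(\mathfrak m|J_2,J_2)=2.$$ Consequently the following question of Trung and Verma has a negative answer in general: if $A$ is a Noetherian local ring of dimension $n+1\ge 3$, $J_1,\dots,J_n$ are ideals of height $n$, and $\mathbf i=(0,1,\dots,1)$, is it true that $$e_{\mathbf i}(\mathfrak m|J_1,J_1,J_3,\dots,J_n)\,e_{\mathbf i}(\mathfrak m|J_2,J_2,J_3,\dots,J_n)\le e_{\mathbf i}(\mathfrak m|J_1,J_2,J_3,\dots,J_n)^2\,?$$ -/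

import Mathlib

/-- A formal power series in `d` variables over `ℂ` is convergent if `∑ ‖aₙ‖ ρ^|n|` is finite for
some polyradius `(ρ, …, ρ)` with `ρ > 0`. -/
def IsConvergentSeries {d : ℕ} (f : MvPowerSeries (Fin d) ℂ) : Prop :=
  ∃ ρ : ℝ, 0 < ρ ∧ Summable fun n : Fin d →₀ ℕ => ‖MvPowerSeries.coeff n f‖ * ρ ^ n.degree

namespace IsConvergentSeries

variable {d : ℕ}

theorem mono {f : MvPowerSeries (Fin d) ℂ} {ρ σ : ℝ} (hσ : 0 ≤ σ) (h : σ ≤ ρ)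
    (hf : Summable fun n : Fin d →₀ ℕ => ‖MvPowerSeries.coeff n f‖ * ρ ^ n.degree) :
    Summable fun n : Fin d →₀ ℕ => ‖MvPowerSeries.coeff n f‖ * σ ^ n.degree := by
  refine Summable.of_nonneg_of_le (fun n => by positivity) (fun n => ?_) hf
  gcongr

theorem monomial (m : Fin d →₀ ℕ) (a : ℂ) :
    IsConvergentSeries (MvPowerSeries.monomial m a) := by
  classical
  refine ⟨1, one_pos, summable_of_ne_finset_zero (s := {m}) fun n hn => ?_⟩
  rw [MvPowerSeries.coeff_monomial_ne (by simpa using hn)]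
  simp

theorem add {f g : MvPowerSeries (Fin d) ℂ} (hf : IsConvergentSeries f)
    (hg : IsConvergentSeries g) : IsConvergentSeries (f + g) := by
  obtain ⟨ρ, hρ, hf⟩ := hf
  obtain ⟨σ, hσ, hg⟩ := hg
  have hτ : 0 < min ρ σ := lt_min hρ hσ
  refine ⟨min ρ σ, hτ, Summable.of_nonneg_of_le (fun n => by positivity) (fun n => ?_)
    ((mono hτ.le (min_le_left _ _) hf).add (mono hτ.le (min_le_right _ _) hg))⟩
  rw [map_add, ← add_mul]
  gcongr
  exact norm_add_le _ _

theorem mul {f g : MvPowerSeries (Fin d) ℂ} (hf : IsConvergentSeries f)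
    (hg : IsConvergentSeries g) : IsConvergentSeries (f * g) := by
  classical
  obtain ⟨ρ, hρ, hf⟩ := hf
  obtain ⟨σ, hσ, hg⟩ := hg
  have hτ : 0 < min ρ σ := lt_min hρ hσ
  have hf := mono hτ.le (min_le_left _ _) hf
  have hg := mono hτ.le (min_le_right _ _) hg
  have h0 := hf.mul_of_nonneg hg (fun n => by positivity) (fun n => by positivity)
  have h := summable_sum_mul_antidiagonal_of_summable_mul
    (f := fun n : Fin d →₀ ℕ => ‖MvPowerSeries.coeff n f‖ * min ρ σ ^ n.degree)
    (g := fun n : Fin d →₀ ℕ => ‖MvPowerSeries.coeff n g‖ * min ρ σ ^ n.degree) h0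
  refine ⟨min ρ σ, hτ, Summable.of_nonneg_of_le (fun n => by positivity) (fun n => ?_) h⟩
  rw [MvPowerSeries.coeff_mul]
  calc ‖∑ p ∈ Finset.HasAntidiagonal.antidiagonal n, MvPowerSeries.coeff p.1 f * MvPowerSeries.coeff p.2 g‖
        * min ρ σ ^ n.degree
      ≤ (∑ p ∈ Finset.HasAntidiagonal.antidiagonal n,
          ‖MvPowerSeries.coeff p.1 f‖ * ‖MvPowerSeries.coeff p.2 g‖) * min ρ σ ^ n.degree := by
        gcongr
        refine (norm_sum_le _ _).trans (le_of_eq ?_)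
        simp
    _ = _ := by
        rw [Finset.sum_mul]
        refine Finset.sum_congr rfl fun p hp => ?_
        rw [← Finset.HasAntidiagonal.mem_antidiagonal.mp hp, map_add, pow_add]
        ring

/-- The inverse of a convergent power series with nonzero constant term is convergent. -/
theorem of_mul_eq_one {f g : MvPowerSeries (Fin d) ℂ} (hf : IsConvergentSeries f)
    (hfg : f * g = 1) : IsConvergentSeries g := by
  classical
  obtain ⟨ρ, hρ, hf⟩ := hf
  set c : ℂ := MvPowerSeries.coeff 0 f with hc
  have hc0 : c ≠ 0 := by
    intro h
    have := congrArg (MvPowerSeries.coeff 0) hfg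
    simp [MvPowerSeries.coeff_mul, ← hc, h] at this
  have hcpos : 0 < ‖c‖ := norm_pos_iff.mpr hc0
  set T : ℝ := ∑' n : Fin d →₀ ℕ, ‖MvPowerSeries.coeff n f‖ * ρ ^ n.degree with hT
  have hT0 : 0 ≤ T := tsum_nonneg fun n => by positivity
  obtain ⟨t, ht0, ht1, htT⟩ : ∃ t : ℝ, 0 < t ∧ t ≤ 1 ∧ t * T ≤ ‖c‖ / 2 := by
    refine ⟨min 1 (‖c‖ / 2 / (T + 1)), by positivity, min_le_left _ _, ?_⟩
    calc min 1 (‖c‖ / 2 / (T + 1)) * T ≤ ‖c‖ / 2 / (T + 1) * (T + 1) := by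
          gcongr
          · exact min_le_right _ _
          · linarith
      _ = ‖c‖ / 2 := by field_simp
  set σ := t * ρ with hσ
  have hσ0 : 0 < σ := by positivity
  set a : (Fin d →₀ ℕ) → ℝ := fun n =>
    if n = 0 then 0 else ‖MvPowerSeries.coeff n f‖ * σ ^ n.degree with ha
  set b : (Fin d →₀ ℕ) → ℝ := fun n => ‖MvPowerSeries.coeff n g‖ * σ ^ n.degree with hb
  have ha0 : ∀ n, 0 ≤ a n := fun n => by simp only [ha]; split_ifs <;> positivity
  have hb0 : ∀ n, 0 ≤ b n := fun n => by simp only [hb]; positivity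
  have hale : ∀ n, a n ≤ t * (‖MvPowerSeries.coeff n f‖ * ρ ^ n.degree) := by
    intro n
    simp only [ha]
    split_ifs with h
    · positivity
    · have hn : n.degree ≠ 0 := fun h0 => h ((Finsupp.degree_eq_zero_iff n).mp h0)
      have h1 : t ^ n.degree ≤ t := pow_le_of_le_one ht0.le ht1 hn
      calc ‖MvPowerSeries.coeff n f‖ * σ ^ n.degree
          = t ^ n.degree * (‖MvPowerSeries.coeff n f‖ * ρ ^ n.degree) := by
            rw [hσ, mul_pow]; ring
        _ ≤ _ := by gcongr
  have hasum : ∀ S : Finset (Fin d →₀ ℕ), ∑ n ∈ S, a n ≤ ‖c‖ / 2 := by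
    intro S
    calc ∑ n ∈ S, a n ≤ ∑ n ∈ S, t * (‖MvPowerSeries.coeff n f‖ * ρ ^ n.degree) :=
          Finset.sum_le_sum fun n _ => hale n
      _ = t * ∑ n ∈ S, ‖MvPowerSeries.coeff n f‖ * ρ ^ n.degree := by rw [Finset.mul_sum]
      _ ≤ t * T := by
          gcongr
          exact hf.sum_le_tsum S fun n _ => by positivity
      _ ≤ _ := htT
  have hrec : ∀ n, n ≠ 0 →
      ‖c‖ * b n ≤ ∑ p ∈ Finset.HasAntidiagonal.antidiagonal n, a p.1 * b p.2 := by
    intro n hn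
    have h0 : ((0 : Fin d →₀ ℕ), n) ∈ Finset.HasAntidiagonal.antidiagonal n := by simp
    have h1 := congrArg (MvPowerSeries.coeff n) hfg
    rw [MvPowerSeries.coeff_mul, MvPowerSeries.coeff_one, if_neg hn,
      ← Finset.add_sum_erase _ _ h0] at h1
    have h2 : ‖c * MvPowerSeries.coeff n g‖ ≤
        ∑ p ∈ (Finset.HasAntidiagonal.antidiagonal n).erase (0, n),
          ‖MvPowerSeries.coeff p.1 f‖ * ‖MvPowerSeries.coeff p.2 g‖ := by
      rw [hc, eq_neg_of_add_eq_zero_left h1, norm_neg]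
      refine (norm_sum_le _ _).trans (le_of_eq ?_)
      simp
    calc ‖c‖ * b n = ‖c * MvPowerSeries.coeff n g‖ * σ ^ n.degree := by
          simp only [hb, norm_mul]; ring
      _ ≤ (∑ p ∈ (Finset.HasAntidiagonal.antidiagonal n).erase (0, n),
          ‖MvPowerSeries.coeff p.1 f‖ * ‖MvPowerSeries.coeff p.2 g‖) * σ ^ n.degree := by
          gcongr
      _ = ∑ p ∈ (Finset.HasAntidiagonal.antidiagonal n).erase (0, n), a p.1 * b p.2 := by
          rw [Finset.sum_mul]
          refine Finset.sum_congr rfl fun p hp => ?_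
          have hp1 := Finset.HasAntidiagonal.mem_antidiagonal.mp (Finset.mem_of_mem_erase hp)
          have hp0 : p.1 ≠ 0 := by
            intro h
            apply Finset.ne_of_mem_erase hp
            rw [h, zero_add] at hp1
            exact Prod.ext h hp1
          simp only [ha, hb, if_neg hp0]
          rw [← hp1, map_add, pow_add]
          ring
      _ ≤ _ := Finset.sum_le_sum_of_subset_of_nonneg (Finset.erase_subset _ _)
          fun p _ _ => mul_nonneg (ha0 _) (hb0 _)
  have hbsum : ∀ m : Fin d →₀ ℕ, ∑ n ∈ Finset.Iic m, b n ≤ 2 * b 0 := by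
    intro m
    set S := Finset.Iic m with hS
    have h0S : (0 : Fin d →₀ ℕ) ∈ S := by simp [hS]
    have h1 : ∑ n ∈ S.erase 0, ‖c‖ * b n ≤ ∑ n ∈ S, ∑ p ∈ Finset.HasAntidiagonal.antidiagonal n, a p.1 * b p.2 :=
      (Finset.sum_le_sum fun n hn => hrec n (Finset.ne_of_mem_erase hn)).trans
        (Finset.sum_le_sum_of_subset_of_nonneg (Finset.erase_subset _ _)
          fun n _ _ => Finset.sum_nonneg fun p _ => mul_nonneg (ha0 _) (hb0 _))
    have h2 : ∑ n ∈ S, ∑ p ∈ Finset.HasAntidiagonal.antidiagonal n, a p.1 * b p.2 ≤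
        ∑ p ∈ S ×ˢ S, a p.1 * b p.2 := by
      have h3 : ∀ n ∈ S, Finset.HasAntidiagonal.antidiagonal n =
          ((S ×ˢ S).filter fun p => p.1 + p.2 ∈ S).filter fun p => p.1 + p.2 = n := by
        intro n hn
        ext p
        simp only [Finset.HasAntidiagonal.mem_antidiagonal, Finset.mem_filter, Finset.mem_product]
        refine ⟨fun h => ?_, fun h => h.2⟩
        have hnm : n ≤ m := by simpa [hS] using hn
        refine ⟨⟨⟨?_, ?_⟩, h ▸ hn⟩, h⟩
        · simpa [hS] using (le_self_add.trans h.le).trans hnm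
        · simpa [hS] using (le_add_self.trans h.le).trans hnm
      rw [Finset.sum_congr rfl fun n hn => by rw [h3 n hn],
        Finset.sum_fiberwise_of_maps_to (fun p hp => (Finset.mem_filter.mp hp).2)]
      exact Finset.sum_le_sum_of_subset_of_nonneg (Finset.filter_subset _ _)
        fun p _ _ => mul_nonneg (ha0 _) (hb0 _)
    rw [Finset.sum_product, ← Finset.sum_mul_sum] at h2
    have h4 : (∑ n ∈ S, a n) * ∑ n ∈ S, b n ≤ ‖c‖ / 2 * ∑ n ∈ S, b n := by
      gcongr
      · exact hasum S
    rw [← Finset.mul_sum] at h1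
    have h5 := Finset.add_sum_erase S b h0S
    have h6 : ‖c‖ * (∑ n ∈ S, b n - b 0) ≤ ‖c‖ * (1 / 2 * ∑ n ∈ S, b n) := by
      rw [← h5, add_sub_cancel_left, h5]
      linarith
    have h7 := le_of_mul_le_mul_left h6 hcpos
    linarith
  refine ⟨σ, hσ0, summable_of_sum_le hb0 (c := 2 * b 0) fun U => ?_⟩
  refine le_trans ?_ (hbsum (U.sup id))
  exact Finset.sum_le_sum_of_subset_of_nonneg
    (fun n hn => Finset.mem_Iic.mpr (Finset.le_sup (f := id) hn)) fun n _ _ => hb0 n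

end IsConvergentSeries

/-- The `ℂ`-subalgebra of convergent power series in `ℂ⟦z₁, …, z_d⟧`. -/
def convergentSubalgebra (d : ℕ) : Subalgebra ℂ (MvPowerSeries (Fin d) ℂ) where
  carrier := {f | IsConvergentSeries f}
  mul_mem' := fun hf hg => IsConvergentSeries.mul hf hg
  add_mem' := fun hf hg => IsConvergentSeries.add hf hg
  algebraMap_mem' := fun a => IsConvergentSeries.monomial 0 a

/-- The ring `ℂ{z₁, …, z_d}` of convergent power series. -/
abbrev ConvergentPowerSeries (d : ℕ) : Type := convergentSubalgebra d

namespace ConvergentPowerSeries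

/-- The `i`-th variable of `ℂ{z₁, …, z_d}`. -/
noncomputable def X {d : ℕ} (i : Fin d) : ConvergentPowerSeries d :=
  ⟨MvPowerSeries.X i, IsConvergentSeries.monomial (Finsupp.single i 1) 1⟩

theorem isUnit_of_constantCoeff_ne_zero {d : ℕ} (f : ConvergentPowerSeries d)
    (h : MvPowerSeries.constantCoeff f.1 ≠ 0) : IsUnit f := by
  have hu : f.1 * MvPowerSeries.invOfUnit f.1 (Units.mk0 _ h) = 1 :=
    MvPowerSeries.mul_invOfUnit _ _ rfl
  exact IsUnit.of_mul_eq_one ⟨_, IsConvergentSeries.of_mul_eq_one f.2 hu⟩ (Subtype.ext hu)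

instance (d : ℕ) : IsLocalRing (ConvergentPowerSeries d) :=
  IsLocalRing.of_isUnit_or_isUnit_one_sub_self fun f => by
    by_cases h : MvPowerSeries.constantCoeff f.1 = 0
    · right
      apply isUnit_of_constantCoeff_ne_zero
      simp [h]
    · exact Or.inl (isUnit_of_constantCoeff_ne_zero f h)

end ConvergentPowerSeries

section MixedMultiplicities

variable {A : Type*} [CommRing A] [IsLocalRing A] {s : ℕ}

open IsLocalRing

/-- The ideal `𝔪^u J₁^{v₁} ⋯ J_s^{v_s}`, where `w = (u, v₁, …, v_s)`. -/
noncomputable def mixedPower (J : Fin s → Ideal A) (w : Fin (s + 1) → ℕ) : Ideal A :=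
  maximalIdeal A ^ w 0 * ∏ j : Fin s, J j ^ w j.succ

/-- The Hilbert function of `R(𝔪 | J₁, …, J_s)`: the dimension over `A / 𝔪` of
`𝔪^u J₁^{v₁} ⋯ J_s^{v_s} / 𝔪^{u+1} J₁^{v₁} ⋯ J_s^{v_s}`. This quotient is `M / 𝔪 M`
for the ideal `M = 𝔪^u J₁^{v₁} ⋯ J_s^{v_s}`. -/
noncomputable def mixedHilbertFunction (J : Fin s → Ideal A) (w : Fin (s + 1) → ℕ) : ℕ :=
  Module.finrank (A ⧸ maximalIdeal A)
    (mixedPower J w ⧸ (maximalIdeal A • (⊤ : Submodule A (mixedPower J w))))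

/-- `P` is the Hilbert polynomial of `R(𝔪 | J₁, …, J_s)`: it agrees with the Hilbert function
whenever all of `u, v₁, …, v_s` are large. -/
def IsMixedHilbertPolynomial (J : Fin s → Ideal A) (P : MvPolynomial (Fin (s + 1)) ℚ) : Prop :=
  ∃ N : ℕ, ∀ w : Fin (s + 1) → ℕ, (∀ j, N ≤ w j) →
    MvPolynomial.eval (fun j => (w j : ℚ)) P = mixedHilbertFunction J w

theorem IsMixedHilbertPolynomial.unique {J : Fin s → Ideal A}
    {P Q : MvPolynomial (Fin (s + 1)) ℚ} (hP : IsMixedHilbertPolynomial J P)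
    (hQ : IsMixedHilbertPolynomial J Q) : P = Q := by
  obtain ⟨N, hN⟩ := hP
  obtain ⟨N', hN'⟩ := hQ
  refine MvPolynomial.funext_set (fun _ => (fun n : ℕ => (n : ℚ)) '' Set.Ici (max N N'))
    (fun _ => (Set.Ici_infinite _).image Nat.cast_injective.injOn) fun x hx => ?_
  choose w hw hwx using fun j => hx j (Set.mem_univ j)
  obtain rfl : (fun j => (w j : ℚ)) = x := funext hwx
  rw [hN w fun j => (le_max_left _ _).trans (hw j), hN' w fun j => (le_max_right _ _).trans (hw j)]

/-- The mixed multiplicity `e_𝐢(𝔪 | J₁, …, J_s)` exists and equals `e`: the Hilbert polynomial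
exists, its total degree is `|𝐢|`, and its coefficient at `u^{i₀} v₁^{i₁} ⋯ v_s^{i_s}` is
`e / (i₀! i₁! ⋯ i_s!)`. -/
def HasMixedMultiplicity (J : Fin s → Ideal A) (i : Fin (s + 1) → ℕ) (e : ℕ) : Prop :=
  ∃ P : MvPolynomial (Fin (s + 1)) ℚ, IsMixedHilbertPolynomial J P ∧
    P.totalDegree = ∑ j, i j ∧
    P.coeff (Finsupp.equivFunOnFinite.symm i) = (e : ℚ) / ((∏ j, (i j).factorial : ℕ) : ℚ)

theorem HasMixedMultiplicity.unique {J : Fin s → Ideal A} {i : Fin (s + 1) → ℕ} {e e' : ℕ}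
    (h : HasMixedMultiplicity J i e) (h' : HasMixedMultiplicity J i e') : e = e' := by
  obtain ⟨P, hP, -, he⟩ := h
  obtain ⟨Q, hQ, -, he'⟩ := h'
  rw [hP.unique hQ, he'] at he
  have h0 : ((∏ j, (i j).factorial : ℕ) : ℚ) ≠ 0 :=
    Nat.cast_ne_zero.mpr (Finset.prod_ne_zero_iff.mpr fun j _ => Nat.factorial_ne_zero _)
  exact_mod_cast ((div_left_inj' h0).mp he).symm

end MixedMultiplicities

/-- The Alexandrov–Fenchel-type inequality for mixed multiplicities, with `n = k + 2`: for every
(Noetherian) local ring `A` of dimension `n + 1 ≥ 3`, all ideals `J₁, J₂, J₃, …, J_n` of height `n`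
and `𝐢 = (0, 1, …, 1)`,
`e_𝐢(𝔪 | J₁, J₁, J₃, …, J_n) e_𝐢(𝔪 | J₂, J₂, J₃, …, J_n) ≤ e_𝐢(𝔪 | J₁, J₂, J₃, …, J_n)²`.
Here `K` is the family `J₃, …, J_n`. -/
def AlexandrovFenchelForMixedMultiplicities.{u} : Prop :=
  ∀ (k : ℕ) (A : Type u) [CommRing A] [IsLocalRing A] [IsNoetherianRing A],
    ringKrullDim A = ((k + 3 : ℕ) : WithBot ℕ∞) →
    ∀ (J₁ J₂ : Ideal A) (K : Fin k → Ideal A),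
      J₁.height = ((k + 2 : ℕ) : ℕ∞) → J₂.height = ((k + 2 : ℕ) : ℕ∞) →
      (∀ j, (K j).height = ((k + 2 : ℕ) : ℕ∞)) →
      ∀ e₁₁ e₁₂ e₂₂ : ℕ,
        HasMixedMultiplicity (Fin.cons J₁ (Fin.cons J₁ K) : Fin (k + 2) → Ideal A)
          (Fin.cons 0 fun _ => 1) e₁₁ →
        HasMixedMultiplicity (Fin.cons J₁ (Fin.cons J₂ K) : Fin (k + 2) → Ideal A)
          (Fin.cons 0 fun _ => 1) e₁₂ →
        HasMixedMultiplicity (Fin.cons J₂ (Fin.cons J₂ K) : Fin (k + 2) → Ideal A)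
          (Fin.cons 0 fun _ => 1) e₂₂ →
        e₁₁ * e₂₂ ≤ e₁₂ ^ 2

/-! Every ideal involved is monomial, so for `M = 𝔪^u J₁^a J₂^b` the dimension of `M / 𝔪M` is the
number of exponents of `M` that are not exponents of `𝔪M` (`mixedHilbertFunction_eq_card`), and the
mixed multiplicities become a lattice-point count.

A product of `i, j, k` factors `xy², y³z, xz` from `J₁` and `i', j', k'` factors `xy², y³z, xz²`
from `J₂` has degree `3(a+b) + (j+j') - k`. An exponent `n` lies in `M` when such a product divides
it and leaves at least `u` degrees to spare. Hence `n` survives in `M / 𝔪M` exactly when its degree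
exceeds by `u` the least degree of a product dividing it; `exists_generator_iff` computes this least
degree. Enumerating these exponents for `u ≥ 1` gives a Hilbert function whose quadratic part is
`u²/2 + (2a+3b)u + a²/2 + ab + b²`. Substituting `(a, b) = (v₁+v₂, 0)`, `(v₁, v₂)`, `(0, v₁+v₂)`
yields the coefficients `1, 1, 2` of `v₁v₂`, and `1 · 2 > 1²`.

It remains to see that the ring satisfies the hypotheses of the question. It is Noetherian by a
division theorem: a generic real weight gives each nonzero series a leading exponent, on small
polydiscs the leading monomial dominates in a weighted `ℓ¹` norm, and division converges as a
Neumann series (`exists_division`). Dickson's lemma then makes finitely many leading exponents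
enough. Its dimension and the heights of `J₁, J₂` come from the primes generated by sets of
variables. -/

open MvPowerSeries Filter
open scoped ENNReal Topology

/-! ### Generic weights on exponents -/

/-- The linear weight `∑ nᵢ wᵢ` of an exponent. -/
noncomputable def wdeg {d : ℕ} (w : Fin d → ℝ) (n : Fin d →₀ ℕ) : ℝ := ∑ i, (n i : ℝ) * w i

section wdeg
variable {d : ℕ} {w : Fin d → ℝ}

theorem wdeg_add (m n : Fin d →₀ ℕ) : wdeg w (m + n) = wdeg w m + wdeg w n := by
  simp [wdeg, add_mul, Finset.sum_add_distrib]

theorem wdeg_nonneg (hw : ∀ i, 0 < w i) (n : Fin d →₀ ℕ) : 0 ≤ wdeg w n :=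
  Finset.sum_nonneg fun i _ => mul_nonneg (Nat.cast_nonneg _) (hw i).le

theorem finite_setOf_wdeg_le (hw : ∀ i, 0 < w i) (c : ℝ) :
    {n : Fin d →₀ ℕ | wdeg w n ≤ c}.Finite := by
  refine (Set.finite_Iic (Finsupp.equivFunOnFinite.symm fun i => ⌊c / w i⌋₊)).subset fun n hn i => ?_
  simp only [Finsupp.coe_equivFunOnFinite_symm]
  apply Nat.le_floor
  rw [le_div_iff₀ (hw i)]
  refine le_trans ?_ hn
  exact Finset.single_le_sum (f := fun i => (n i : ℝ) * w i)
    (fun i _ => mul_nonneg (Nat.cast_nonneg _) (hw i).le) (Finset.mem_univ i)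

/-- There are positive weights that separate exponents. -/
theorem exists_generic_weight (d : ℕ) :
    ∃ w : Fin d → ℝ, (∀ i, 0 < w i) ∧ Function.Injective (wdeg w) := by
  obtain ⟨v, hv⟩ : ∃ v : Fin d → ℝ, LinearIndependent ℚ v := by
    have h : (d : Cardinal) ≤ Module.rank ℚ ℝ := by
      rw [Real.rank_rat_real]
      exact (Cardinal.natCast_lt_aleph0).le.trans Cardinal.aleph0_le_continuum
    obtain ⟨s, hs, hli⟩ := le_rank_iff_exists_linearIndependent.mp h
    have : Fintype s := (Cardinal.lt_aleph0_iff_fintype.mp (hs ▸ Cardinal.natCast_lt_aleph0)).some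
    have hc : Fintype.card s = d := by
      have := hs
      rw [Cardinal.mk_fintype] at this
      exact_mod_cast this
    exact ⟨_, hli.comp (Fintype.equivFinOfCardEq hc).symm (Equiv.injective _)⟩
  -- Absolute values make the weights positive; the signs move into the rational coefficients, so
  -- linear independence still applies.
  refine ⟨fun i => |v i|, fun i => abs_pos.mpr (hv.ne_zero i), fun m n hmn => ?_⟩
  have h := Fintype.linearIndependent_iff.mp hv
    (fun i => ((m i : ℚ) - n i) * (if 0 ≤ v i then 1 else -1)) (by
      have : ∑ i, ((m i : ℝ) - n i) * |v i| = 0 := by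
        simp only [sub_mul, Finset.sum_sub_distrib]
        exact sub_eq_zero.mpr hmn
      refine Eq.trans (Finset.sum_congr rfl fun i _ => ?_) this
      rw [Rat.smul_def]
      split_ifs with h0
      · rw [abs_of_nonneg h0]; push_cast; ring
      · rw [abs_of_neg (not_le.mp h0)]; push_cast; ring)
  ext i
  have h2 := h i
  split_ifs at h2 <;> simp [sub_eq_zero] at h2 <;> omega

end wdeg

/-! ### Weighted `ℓ¹` norms -/

/-- The factor `exp (-s ⟨w, n⟩)` of the exponent `n`. -/
noncomputable def wexp {d : ℕ} (w : Fin d → ℝ) (s : ℝ) (n : Fin d →₀ ℕ) : ℝ≥0∞ :=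
  ENNReal.ofReal (Real.exp (-s * wdeg w n))

/-- The weighted `ℓ¹` norm `∑ ‖fₙ‖ exp (-s ⟨w, n⟩)`. -/
noncomputable def wnorm {d : ℕ} (w : Fin d → ℝ) (s : ℝ) (f : MvPowerSeries (Fin d) ℂ) : ℝ≥0∞ :=
  ∑' n, ‖coeff n f‖ₑ * wexp w s n

section wnorm
variable {d : ℕ} {w : Fin d → ℝ} {s : ℝ}

theorem wexp_add (m n : Fin d →₀ ℕ) : wexp w s (m + n) = wexp w s m * wexp w s n := by
  rw [wexp, wdeg_add, mul_add, Real.exp_add, ENNReal.ofReal_mul (Real.exp_nonneg _)]; rfl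

theorem wexp_ne_zero (n : Fin d →₀ ℕ) : wexp w s n ≠ 0 := by
  simp [wexp, Real.exp_pos]

theorem wnorm_add_le (f g : MvPowerSeries (Fin d) ℂ) :
    wnorm w s (f + g) ≤ wnorm w s f + wnorm w s g := by
  rw [wnorm, wnorm, wnorm, ← ENNReal.tsum_add]
  refine ENNReal.tsum_le_tsum fun n => ?_
  rw [← add_mul, map_add]
  gcongr
  exact enorm_add_le _ _

theorem wnorm_sum_le {ι : Type*} (t : Finset ι) (f : ι → MvPowerSeries (Fin d) ℂ) :
    wnorm w s (∑ i ∈ t, f i) ≤ ∑ i ∈ t, wnorm w s (f i) := by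
  classical
  induction t using Finset.induction_on with
  | empty => simp [wnorm]
  | insert a t ha ih =>
    rw [Finset.sum_insert ha, Finset.sum_insert ha]
    exact (wnorm_add_le _ _).trans (by gcongr)

theorem wnorm_mul_le (f g : MvPowerSeries (Fin d) ℂ) :
    wnorm w s (f * g) ≤ wnorm w s f * wnorm w s g := by
  classical
  have h : wnorm w s f * wnorm w s g = ∑' n : Fin d →₀ ℕ,
      ∑ p ∈ Finset.HasAntidiagonal.antidiagonal n,
        (‖coeff p.1 f‖ₑ * wexp w s p.1) * (‖coeff p.2 g‖ₑ * wexp w s p.2) := by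
    rw [wnorm, wnorm, ← ENNReal.tsum_mul_right]
    simp_rw [← ENNReal.tsum_mul_left]
    rw [← ENNReal.tsum_prod,
      ← (Finset.HasAntidiagonal.sigmaAntidiagonalEquivProd (A := Fin d →₀ ℕ)).tsum_eq, ENNReal.tsum_sigma']
    refine tsum_congr fun n => ?_
    rw [tsum_fintype]
    exact Finset.sum_coe_sort (Finset.HasAntidiagonal.antidiagonal n) (fun p =>
      (‖coeff p.1 f‖ₑ * wexp w s p.1) * (‖coeff p.2 g‖ₑ * wexp w s p.2))
  rw [h, wnorm]
  refine ENNReal.tsum_le_tsum fun n => ?_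
  rw [coeff_mul]
  refine (mul_le_mul_left (enorm_sum_le _ _) _).trans ?_
  rw [Finset.sum_mul]
  refine Finset.sum_le_sum fun p hp => ?_
  rw [← Finset.HasAntidiagonal.mem_antidiagonal.mp hp, wexp_add, enorm_mul]
  exact le_of_eq (by ring)

theorem wnorm_anti (hw : ∀ i, 0 < w i) (f : MvPowerSeries (Fin d) ℂ) {s t : ℝ} (h : s ≤ t) :
    wnorm w t f ≤ wnorm w s f := by
  refine ENNReal.tsum_le_tsum fun n => ?_
  rw [wexp, wexp]
  have := wdeg_nonneg hw n
  gcongr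

/-- For `s` large, `exp (-s wᵢ) ≤ ρ` for every `i`, so the weighted polydisc sits inside the one of
polyradius `ρ`. -/
theorem IsConvergentSeries.exists_wnorm_ne_top (hw : ∀ i, 0 < w i)
    {f : MvPowerSeries (Fin d) ℂ} (hf : IsConvergentSeries f) : ∃ s, wnorm w s f ≠ ⊤ := by
  obtain ⟨ρ, hρ, hf⟩ := hf
  obtain ⟨s, hs⟩ : ∃ s : ℝ, ∀ i, -s * w i ≤ Real.log ρ := by
    have h : ∀ i, ∀ᶠ s : ℝ in atTop, -s * w i ≤ Real.log ρ := fun i => by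
      filter_upwards [eventually_ge_atTop (-Real.log ρ / w i)] with s hs
      rw [div_le_iff₀ (hw i)] at hs
      linarith
    exact (eventually_all.mpr h).exists
  refine ⟨s, ne_top_of_le_ne_top (hf.tsum_ofReal_ne_top) (ENNReal.tsum_le_tsum fun n => ?_)⟩
  rw [ENNReal.ofReal_mul (norm_nonneg _), ofReal_norm, wexp]
  gcongr
  rw [← Real.exp_log (pow_pos hρ _), Real.log_pow]
  apply Real.exp_le_exp.mpr
  rw [wdeg, Finset.mul_sum, Finsupp.degree_eq_sum, Nat.cast_sum, Finset.sum_mul]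
  refine Finset.sum_le_sum fun i _ => ?_
  rw [mul_left_comm]
  gcongr
  exact hs i

theorem IsConvergentSeries.of_wnorm_ne_top (hw : ∀ i, 0 < w i)
    {f : MvPowerSeries (Fin d) ℂ} (hf : wnorm w s f ≠ ⊤) : IsConvergentSeries f := by
  -- A nonnegative parameter is needed below: `⟨w, n⟩ ≤ |n| ∑ wᵢ` is multiplied by `-t`.
  have hf' := ne_top_of_le_ne_top hf (wnorm_anti hw f (le_max_left s 0))
  set t := max s 0
  have ht : 0 ≤ t := le_max_right _ _
  refine ⟨Real.exp (-t * ∑ i, w i), Real.exp_pos _, ?_⟩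
  have h := ENNReal.summable_toReal hf'
  refine Summable.of_nonneg_of_le (fun n => by positivity) (fun n => ?_) h
  rw [ENNReal.toReal_mul, toReal_enorm, wexp, ENNReal.toReal_ofReal (Real.exp_nonneg _),
    ← Real.exp_nat_mul]
  refine mul_le_mul_of_nonneg_left (Real.exp_le_exp.mpr ?_) (norm_nonneg _)
  rw [← mul_assoc, mul_comm (_ : ℝ) (-t), mul_assoc, neg_mul, neg_mul]
  apply neg_le_neg
  gcongr
  rw [wdeg, Finset.mul_sum]
  refine Finset.sum_le_sum fun i _ => ?_
  have := (hw i).le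
  gcongr
  exact Finsupp.le_degree i n

end wnorm

/-! ### Division of convergent power series -/

section division
variable {d : ℕ} {w : Fin d → ℝ} {s : ℝ}

/-- Only finitely many exponents have weight at most `c + 1`: either the support avoids them all, or
one of them attains the least weight. -/
theorem coeff_ne_zero_wdeg_gap (hw : ∀ i, 0 < w i) {h : MvPowerSeries (Fin d) ℂ}
    {c : ℝ} (hc : ∀ n, coeff n h ≠ 0 → c < wdeg w n) :
    ∃ δ > 0, ∀ n, coeff n h ≠ 0 → c + δ ≤ wdeg w n := by
  classical
  set t := ((finite_setOf_wdeg_le hw (c + 1)).toFinset.filter fun n => coeff n h ≠ 0)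
  rcases t.eq_empty_or_nonempty with ht | ht
  · refine ⟨1, one_pos, fun n hn => ?_⟩
    by_contra! hlt
    have : n ∈ t := by simpa [t] using ⟨hlt.le, hn⟩
    simp [ht] at this
  · obtain ⟨m, hm, hmin⟩ := t.exists_min_image (wdeg w) ht
    have hm' := (Finset.mem_filter.mp hm).2
    refine ⟨wdeg w m - c, sub_pos.mpr (hc m hm'), fun n hn => ?_⟩
    by_contra! hlt
    have hm1 : wdeg w m ≤ c + 1 := by simpa using (Finset.mem_filter.mp hm).1
    have : n ∈ t := by
      simp only [t, Finset.mem_filter, Set.Finite.mem_toFinset, Set.mem_ofPred_eq]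
      exact ⟨by linarith, hn⟩
    linarith [hmin n this]

/-- If all exponents of `h` have larger weight than `α`, then `h` becomes negligible compared with
the monomial of exponent `α` on small polydiscs. -/
theorem eventually_wnorm_le (hw : ∀ i, 0 < w i) {h : MvPowerSeries (Fin d) ℂ}
    (hconv : IsConvergentSeries h) {α : Fin d →₀ ℕ}
    (hα : ∀ n, coeff n h ≠ 0 → wdeg w α < wdeg w n) {ε : ℝ} (hε : 0 < ε) :
    ∀ᶠ s in atTop, wnorm w s h ≤ ENNReal.ofReal ε * wexp w s α := by
  obtain ⟨s₀, hs₀⟩ := hconv.exists_wnorm_ne_top hw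
  obtain ⟨δ, hδ, hgap⟩ := coeff_ne_zero_wdeg_gap hw hα
  set C := (wnorm w s₀ h).toReal * Real.exp (s₀ * (wdeg w α + δ)) with hC
  have hlim : Tendsto (fun s : ℝ => C * Real.exp (-(s * δ))) atTop (𝓝 (C * 0)) :=
    (Real.tendsto_exp_neg_atTop_nhds_zero.comp (tendsto_id.atTop_mul_const hδ)).const_mul C
  rw [mul_zero] at hlim
  filter_upwards [hlim.eventually_le_const hε, eventually_ge_atTop s₀] with s hs hss
  -- Passing from `s₀` to `s` gains this factor on every exponent of `h`; compared with the monomial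
  -- of exponent `α`, the surplus `δ` leaves `exp (-sδ)`, which tends to `0`.
  have h1 : wnorm w s h ≤
      ENNReal.ofReal (Real.exp (-(s - s₀) * (wdeg w α + δ))) * wnorm w s₀ h := by
    rw [wnorm, wnorm, ← ENNReal.tsum_mul_left]
    refine ENNReal.tsum_le_tsum fun n => ?_
    by_cases hn : coeff n h = 0
    · simp [hn]
    rw [mul_left_comm]
    gcongr
    rw [wexp, wexp, ← ENNReal.ofReal_mul (Real.exp_nonneg _), ← Real.exp_add]
    apply ENNReal.ofReal_le_ofReal
    apply Real.exp_le_exp.mpr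
    nlinarith [mul_le_mul_of_nonneg_left (hgap n hn) (sub_nonneg.mpr hss)]
  refine h1.trans ?_
  rw [← ENNReal.ofReal_toReal hs₀, wexp, ← ENNReal.ofReal_mul (Real.exp_nonneg _),
    ← ENNReal.ofReal_mul hε.le]
  apply ENNReal.ofReal_le_ofReal
  calc Real.exp (-(s - s₀) * (wdeg w α + δ)) * (wnorm w s₀ h).toReal
      = C * Real.exp (-(s * δ)) * Real.exp (-s * wdeg w α) := by
        rw [hC, mul_assoc, mul_assoc, ← Real.exp_add, ← Real.exp_add, mul_comm]
        congr 2; ring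
    _ ≤ _ := by gcongr

/-- The quotient by the monomial of exponent `α` of the part of `h` supported on the exponents
`n ≥ α` with `p n`. -/
noncomputable def shiftPart (p : (Fin d →₀ ℕ) → Prop) (α : Fin d →₀ ℕ)
    (h : MvPowerSeries (Fin d) ℂ) : MvPowerSeries (Fin d) ℂ :=
  open Classical in fun m => if p (m + α) then coeff (m + α) h else 0

open Classical in
theorem coeff_shiftPart (p : (Fin d →₀ ℕ) → Prop) (α m : Fin d →₀ ℕ)
    (h : MvPowerSeries (Fin d) ℂ) :
    coeff m (shiftPart p α h) = if p (m + α) then coeff (m + α) h else 0 := rfl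

open Classical in
theorem coeff_monomial_mul_shiftPart {p : (Fin d →₀ ℕ) → Prop} {α : Fin d →₀ ℕ}
    (hp : ∀ n, p n → α ≤ n) (h : MvPowerSeries (Fin d) ℂ) (n : Fin d →₀ ℕ) :
    coeff n (monomial α 1 * shiftPart p α h) = if p n then coeff n h else 0 := by
  rw [coeff_monomial_mul, one_mul, coeff_shiftPart]
  by_cases hn : α ≤ n
  · rw [if_pos hn, tsub_add_cancel_of_le hn]
  · rw [if_neg hn, if_neg fun h => hn (hp n h)]

open Classical in
theorem wexp_mul_wnorm_shiftPart_le (p : (Fin d →₀ ℕ) → Prop) (α : Fin d →₀ ℕ)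
    (h : MvPowerSeries (Fin d) ℂ) :
    wexp w s α * wnorm w s (shiftPart p α h) ≤
      ∑' n, if p n then ‖coeff n h‖ₑ * wexp w s n else 0 := by
  rw [wnorm, ← ENNReal.tsum_mul_left]
  refine le_trans (ENNReal.tsum_le_tsum fun m => ?_)
    (ENNReal.tsum_comp_le_tsum_of_injective (add_left_injective α) _)
  rw [coeff_shiftPart]
  split_ifs
  · rw [wexp_add]; exact le_of_eq (by ring)
  · simp

theorem IsConvergentSeries.shiftPart {h : MvPowerSeries (Fin d) ℂ} (hh : IsConvergentSeries h)
    (p : (Fin d →₀ ℕ) → Prop) (α : Fin d →₀ ℕ) : IsConvergentSeries (shiftPart p α h) := by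
  classical
  have hw : ∀ i : Fin d, 0 < (fun _ => 1 : Fin d → ℝ) i := fun _ => one_pos
  obtain ⟨s, hs⟩ := hh.exists_wnorm_ne_top hw
  refine .of_wnorm_ne_top (s := s) hw fun htop => ?_
  have h1 := wexp_mul_wnorm_shiftPart_le (w := fun _ => 1) (s := s) p α h
  rw [htop, ENNReal.mul_top (wexp_ne_zero _), top_le_iff] at h1
  refine ne_top_of_le_ne_top hs (ENNReal.tsum_le_tsum fun n => ?_) h1
  split_ifs <;> simp

/-- Division of convergent power series by series with prescribed leading exponents: `c` assigns
to each exponent one of the leading exponents below it, or `none`. -/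
theorem exists_division {ι : Type*} [Fintype ι] (hw : ∀ i, 0 < w i) (α : ι → Fin d →₀ ℕ)
    (g : ι → MvPowerSeries (Fin d) ℂ) (hg : ∀ i, IsConvergentSeries (g i))
    (hlead : ∀ i, coeff (α i) (g i) = 1)
    (htail : ∀ i n, n ≠ α i → coeff n (g i) ≠ 0 → wdeg w (α i) < wdeg w n)
    (c : (Fin d →₀ ℕ) → Option ι) (hc : ∀ n i, c n = some i → α i ≤ n)
    {f : MvPowerSeries (Fin d) ℂ} (hf : IsConvergentSeries f) :
    ∃ (q : ι → MvPowerSeries (Fin d) ℂ) (r : MvPowerSeries (Fin d) ℂ),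
      (∀ i, IsConvergentSeries (q i)) ∧ IsConvergentSeries r ∧
      (∀ n, coeff n r ≠ 0 → c n = none) ∧ f = ∑ i, q i * g i + r := by
  classical
  -- The values of `c` partition the exponents, so the quotients and the remainder use disjoint
  -- parts of `h` and their norms add up without double counting.
  set q : MvPowerSeries (Fin d) ℂ → ι → MvPowerSeries (Fin d) ℂ :=
    fun h i => shiftPart (fun n => c n = some i) (α i) h with hq
  set r : MvPowerSeries (Fin d) ℂ → MvPowerSeries (Fin d) ℂ :=
    fun h => shiftPart (fun n => c n = none) 0 h with hr
  set S : MvPowerSeries (Fin d) ℂ → MvPowerSeries (Fin d) ℂ :=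
    fun h => ∑ i, q h i * g i + r h with hS
  set t : ι → MvPowerSeries (Fin d) ℂ := fun i => monomial (α i) 1 - g i with ht
  have htconv : ∀ i, IsConvergentSeries (t i) := fun i => by
    have := (hg i).mul (IsConvergentSeries.monomial 0 (-1))
    rw [ht]
    convert (IsConvergentSeries.monomial (α i) 1).add this using 1
    ext n
    simp [sub_eq_add_neg]
  have htcoeff : ∀ i n, coeff n (t i) ≠ 0 → wdeg w (α i) < wdeg w n := by
    intro i n hn
    rcases eq_or_ne n (α i) with rfl | hne
    · simp [ht, hlead] at hn
    · refine htail i n hne fun h0 => hn ?_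
      simp [ht, h0, coeff_monomial_ne hne]
  have hdecomp : ∀ h, h = ∑ i, monomial (α i) 1 * q h i + r h := by
    intro h
    ext n
    have h1 : ∀ i, coeff n (monomial (α i) 1 * q h i) = if c n = some i then coeff n h else 0 :=
      fun i => by convert coeff_monomial_mul_shiftPart (fun n hn => hc n i hn) h n
    simp only [map_add, map_sum, h1, hr, coeff_shiftPart, add_zero]
    cases hcn : c n with
    | none => simp
    | some j => simp
  have hdiff : ∀ h, h - S h = ∑ i, q h i * t i := by
    intro h
    nth_rewrite 1 [hdecomp h]
    rw [hS, add_sub_add_right_eq_sub, ← Finset.sum_sub_distrib]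
    exact Finset.sum_congr rfl fun i _ => by rw [ht]; ring
  obtain ⟨s₀, hs₀⟩ := hf.exists_wnorm_ne_top hw
  obtain ⟨s, hs, hss⟩ := ((eventually_all.mpr fun i =>
    eventually_wnorm_le hw (htconv i) (htcoeff i) (one_half_pos (α := ℝ))).and
      (eventually_ge_atTop s₀)).exists
  have hfs : wnorm w s f ≠ ⊤ := ne_top_of_le_ne_top hs₀ (wnorm_anti hw f hss)
  have hcontr : ∀ h, wnorm w s (h - S h) ≤ ENNReal.ofReal (1 / 2) * wnorm w s h := by
    intro h
    rw [hdiff]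
    calc wnorm w s (∑ i, q h i * t i) ≤ ∑ i, wnorm w s (q h i * t i) := wnorm_sum_le _ _
      _ ≤ ∑ i, ENNReal.ofReal (1 / 2) *
            ∑' n, if c n = some i then ‖coeff n h‖ₑ * wexp w s n else 0 := by
          refine Finset.sum_le_sum fun i _ => (wnorm_mul_le _ _).trans ?_
          calc wnorm w s (q h i) * wnorm w s (t i)
              ≤ wnorm w s (q h i) * (ENNReal.ofReal (1 / 2) * wexp w s (α i)) := by
                gcongr; exact hs i
            _ = ENNReal.ofReal (1 / 2) * (wexp w s (α i) * wnorm w s (q h i)) := by ring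
            _ ≤ _ := by
                refine mul_le_mul_right ((wexp_mul_wnorm_shiftPart_le (fun n => c n = some i)
                  (α i) h).trans_eq (tsum_congr fun n => ?_)) _
                congr
      _ ≤ _ := by
          rw [← Finset.mul_sum]
          gcongr
          rw [← Summable.tsum_finsetSum fun _ _ => ENNReal.summable]
          refine ENNReal.tsum_le_tsum fun n => ?_
          cases hcn : c n with
          | none => simp
          | some j => simp
  -- Neumann series: since `1 - S` contracts by `1/2`, the sum `h` of the iterates `(1 - S)^k f`
  -- solves `S h = f`.
  set F : ℕ → MvPowerSeries (Fin d) ℂ := fun k => (fun h => h - S h)^[k] f with hF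
  have hFsucc : ∀ k, F (k + 1) = F k - S (F k) := fun k => Function.iterate_succ_apply' _ _ _
  have hFnorm : ∀ k, wnorm w s (F k) ≤ ENNReal.ofReal (1 / 2) ^ k * wnorm w s f := by
    intro k
    induction k with
    | zero => simp [hF]
    | succ k ih =>
      rw [hFsucc, pow_succ', mul_assoc]
      exact (hcontr _).trans (by gcongr)
  have hsumF : ∑' k, wnorm w s (F k) ≠ ⊤ := by
    refine ne_top_of_le_ne_top ?_ (ENNReal.tsum_le_tsum hFnorm)
    rw [ENNReal.tsum_mul_right, ENNReal.tsum_geometric]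
    refine ENNReal.mul_ne_top (ENNReal.inv_ne_top.mpr ?_) hfs
    rw [← ENNReal.ofReal_one, ← ENNReal.ofReal_sub _ (by norm_num)]
    norm_num
  have hcoeffF : ∀ n, Summable fun k => coeff n (F k) := by
    intro n
    refine Summable.of_enorm ?_
    have h1 : (∑' k, ‖coeff n (F k)‖ₑ) * wexp w s n ≤ ∑' k, wnorm w s (F k) := by
      rw [← ENNReal.tsum_mul_right]
      exact ENNReal.tsum_le_tsum fun k =>
        ENNReal.le_tsum (f := fun n => ‖coeff n (F k)‖ₑ * wexp w s n) n
    intro htop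
    rw [htop, ENNReal.top_mul (wexp_ne_zero _), top_le_iff] at h1
    exact hsumF h1
  set h : MvPowerSeries (Fin d) ℂ := fun n => ∑' k, coeff n (F k) with hh
  have hhas : ∀ n, HasSum (fun k => coeff n (F k)) (coeff n h) := fun n => (hcoeffF n).hasSum
  have hhconv : IsConvergentSeries h := by
    refine .of_wnorm_ne_top (s := s) hw (ne_top_of_le_ne_top hsumF ?_)
    simp only [wnorm]
    rw [ENNReal.tsum_comm]
    refine ENNReal.tsum_le_tsum fun n => ?_
    rw [ENNReal.tsum_mul_right]
    gcongr
    exact enorm_tsum_le_tsum_enorm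
  have hpart : ∀ (p : (Fin d →₀ ℕ) → Prop) (β n : Fin d →₀ ℕ),
      HasSum (fun k => coeff n (shiftPart p β (F k))) (coeff n (shiftPart p β h)) := by
    intro p β n
    simp only [coeff_shiftPart]
    split_ifs
    · exact hhas _
    · exact hasSum_zero
  have hSh : ∀ n, HasSum (fun k => coeff n (S (F k))) (coeff n (S h)) := by
    intro n
    simp only [hS, map_add, map_sum, coeff_mul]
    exact (hasSum_sum fun i _ => hasSum_sum fun p _ => (hpart _ _ _).mul_right _).add (hpart _ _ _)
  have hlim0 : ∀ n, Tendsto (fun k => coeff n (F k)) atTop (𝓝 0) :=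
    fun n => (hcoeffF n).tendsto_atTop_zero
  have hfS : f = S h := by
    ext n
    refine tendsto_nhds_unique ?_ (hSh n).tendsto_sum_nat
    -- The partial sums telescope because `S (F k) = F k - F (k+1)`.
    have h1 : ∀ K, ∑ k ∈ Finset.range K, coeff n (S (F k)) = coeff n f - coeff n (F K) := by
      intro K
      induction K with
      | zero => simp [hF]
      | succ K ih =>
        rw [Finset.sum_range_succ, ih, hFsucc, map_sub]
        ring
    simp_rw [h1]
    simpa using (hlim0 n).const_sub (coeff n f)
  refine ⟨q h, r h, fun i => hhconv.shiftPart _ _, hhconv.shiftPart _ _, fun n hn => ?_, hfS⟩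
  by_contra hcn
  simp [hr, coeff_shiftPart, hcn] at hn

end division

/-! ### Dickson's lemma and Noetherianity -/

/-- Dickson's lemma: the minimal elements of `E` form an antichain, and antichains in `ℕ^d` are
finite. -/
theorem Finsupp.exists_finite_subset_forall_exists_le {d : ℕ} (E : Set (Fin d →₀ ℕ)) :
    ∃ G ⊆ E, G.Finite ∧ ∀ n ∈ E, ∃ m ∈ G, m ≤ n := by
  refine ⟨{m | Minimal (· ∈ E) m}, fun m hm => hm.1,
    WellQuasiOrderedLE.finite_of_isAntichain (setOfPred_minimal_antichain _), fun n hn => ?_⟩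
  obtain ⟨m, hm, hmin⟩ := exists_minimal_le_of_wellFoundedLT (· ∈ E) n hn
  exact ⟨m, hmin, hm⟩

/-- The ring of convergent power series is Noetherian. -/
instance ConvergentPowerSeries.isNoetherianRing (d : ℕ) :
    IsNoetherianRing (ConvergentPowerSeries d) := by
  classical
  obtain ⟨w, hw, hinj⟩ := exists_generic_weight d
  refine ⟨fun (I : Ideal (ConvergentPowerSeries d)) => ?_⟩
  -- The leading exponents of elements of `I`, normalised to leading coefficient `1`.
  set E : Set (Fin d →₀ ℕ) := {α | ∃ g ∈ I, coeff α g.1 = 1 ∧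
    ∀ n, n ≠ α → coeff n g.1 ≠ 0 → wdeg w α < wdeg w n} with hE
  have hmem : ∀ f ∈ I, f ≠ 0 → ∃ α ∈ E, coeff α f.1 ≠ 0 := by
    intro f hf hf0
    obtain ⟨n, hn⟩ : ∃ n, coeff n f.1 ≠ 0 := by
      by_contra! h
      exact hf0 (Subtype.ext (MvPowerSeries.ext h))
    set t := (finite_setOf_wdeg_le hw (wdeg w n)).toFinset.filter fun m => coeff m f.1 ≠ 0
    have hnt : n ∈ t := by simpa [t] using hn
    obtain ⟨α, hα, hmin⟩ := t.exists_min_image (wdeg w) ⟨n, hnt⟩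
    have hα0 : coeff α f.1 ≠ 0 := (Finset.mem_filter.mp hα).2
    have hcoeff : ∀ m, coeff m ((coeff α f.1)⁻¹ • f : ConvergentPowerSeries d).1 =
        (coeff α f.1)⁻¹ * coeff m f.1 := fun m => by
      simp
    refine ⟨α, ⟨(coeff α f.1)⁻¹ • f, ?_, ?_, fun m hm hm0 => ?_⟩, hα0⟩
    · rw [Algebra.smul_def]; exact I.mul_mem_left _ hf
    · rw [hcoeff, inv_mul_cancel₀ hα0]
    · rw [hcoeff] at hm0
      by_contra! hlt
      have hmt : m ∈ t := by
        simp only [t, Finset.mem_filter, Set.Finite.mem_toFinset, Set.mem_ofPred_eq]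
        exact ⟨hlt.trans (hmin n hnt), right_ne_zero_of_mul hm0⟩
      exact hm (hinj (le_antisymm hlt (hmin m hmt)))
  obtain ⟨G, hGE, hGfin, hG⟩ := Finsupp.exists_finite_subset_forall_exists_le E
  have := hGfin.fintype
  choose g hgI hg1 hg2 using fun a : G => hGE a.2
  have hc : ∀ n, ∃ o : Option G, (∀ i, o = some i → i.1 ≤ n) ∧ (o = none → n ∉ E) := by
    intro n
    by_cases hn : n ∈ E
    · obtain ⟨m, hm, hmn⟩ := hG n hn
      exact ⟨some ⟨m, hm⟩, by rintro i ⟨⟩; exact hmn, by simp⟩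
    · exact ⟨none, by simp, fun _ => hn⟩
  choose c hc1 hc2 using hc
  -- The remainder of dividing `f ∈ I` again lies in `I` and has no exponent in `E`; a nonzero
  -- element of `I` has its leading exponent in `E`, so the remainder vanishes.
  have hspan : Ideal.span (Set.range g) = I := by
    refine le_antisymm (Ideal.span_le.mpr (Set.range_subset_iff.mpr hgI)) fun f hf => ?_
    obtain ⟨q, r, hq, hr, hrc, hfqr⟩ := exists_division hw (fun a : G => a.1) (fun a => (g a).1)
      (fun a => (g a).2) hg1 hg2 c hc1 f.2
    have hsum : f = ∑ a, (⟨q a, hq a⟩ : ConvergentPowerSeries d) * g a + ⟨r, hr⟩ := by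
      apply Subtype.ext
      rw [hfqr]
      simp
    have hS : ∑ a, (⟨q a, hq a⟩ : ConvergentPowerSeries d) * g a ∈ Ideal.span (Set.range g) :=
      Ideal.sum_mem _ fun a _ => Ideal.mul_mem_left _ _ (Ideal.subset_span ⟨a, rfl⟩)
    have hrI : (⟨r, hr⟩ : ConvergentPowerSeries d) ∈ I := by
      rw [eq_sub_of_add_eq' hsum.symm]
      exact I.sub_mem hf (Ideal.span_le.mpr (Set.range_subset_iff.mpr hgI) hS)
    have hr0 : (⟨r, hr⟩ : ConvergentPowerSeries d) = 0 := by
      by_contra hne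
      obtain ⟨α, hα, hα0⟩ := hmem _ hrI hne
      exact hc2 α (hrc α hα0) hα
    rw [hsum, hr0, add_zero]
    exact hS
  rw [← hspan]
  exact ⟨(Set.finite_range g).toFinset, by simp⟩

open IsLocalRing in
/-- If `φ` identifies `M / 𝔪 M` with a coordinate space over the residue field `k`, then the number
of coordinates is the minimal number of generators of `M`. -/
theorem finrank_quotient_maximalIdeal_smul {k A ι : Type*} [Field k] [CommRing A] [IsLocalRing A]
    [Algebra k A] [Fintype ι] (M : Ideal A) (φ : M →ₗ[k] (ι → k)) (hφ : Function.Surjective φ)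
    (hker : ∀ f : M, φ f = 0 ↔ (f : A) ∈ maximalIdeal A * M) (ε : A →+* k)
    (hε : ∀ a ∈ maximalIdeal A, ε a = 0) (hεsurj : Function.Surjective ε)
    (hφsmul : ∀ (a : A) (f : M), φ (a • f) = ε a • φ f) :
    Module.finrank (A ⧸ maximalIdeal A) (M ⧸ (maximalIdeal A • (⊤ : Submodule A M))) =
      Fintype.card ι := by
  have hker' : LinearMap.ker φ =
      (maximalIdeal A • (⊤ : Submodule A M)).restrictScalars k := by
    ext f
    rw [LinearMap.mem_ker, Submodule.restrictScalars_mem, Submodule.mem_smul_top_iff,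
      smul_eq_mul, hker]
  let i : (A ⧸ maximalIdeal A) →+* k := Ideal.Quotient.lift _ ε hε
  have hi : Function.Bijective i := by
    let := Ideal.Quotient.field (maximalIdeal A)
    exact ⟨RingHom.injective i, Ideal.Quotient.lift_surjective_of_surjective _ hε hεsurj⟩
  let j : (M ⧸ (maximalIdeal A • (⊤ : Submodule A M))) ≃ₗ[k] (ι → k) :=
    (Submodule.Quotient.restrictScalarsEquiv k _).symm ≪≫ₗ
      Submodule.quotEquivOfEq _ _ hker'.symm ≪≫ₗ φ.quotKerEquivOfSurjective hφ
  have hj : ∀ f : M, j (Submodule.Quotient.mk f) = φ f := fun f => rfl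
  have hc : ∀ (r : A ⧸ maximalIdeal A)
      (m : M ⧸ (maximalIdeal A • (⊤ : Submodule A M))), j (r • m) = i r • j m := by
    intro r m
    obtain ⟨a, rfl⟩ := Ideal.Quotient.mk_surjective r
    obtain ⟨f, rfl⟩ := Submodule.Quotient.mk_surjective _ m
    change j (Submodule.Quotient.mk (a • f)) = ε a • j (Submodule.Quotient.mk f)
    rw [hj, hj, hφsmul]
  -- The two sides are spaces over different fields, so ranks are compared along the isomorphism `i`
  -- of `A / 𝔪` with `k`.
  have h := lift_rank_eq_of_equiv_equiv i j.toAddEquiv hi hc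
  rw [Module.finrank, ← Cardinal.toNat_lift, h]
  simp

/-! ### Monomial ideals, variable primes and dimension -/

namespace ConvergentPowerSeries

variable {d : ℕ}

/-- The monomial of exponent `n` as a convergent power series. -/
noncomputable def mon (n : Fin d →₀ ℕ) : ConvergentPowerSeries d :=
  ⟨monomial n 1, IsConvergentSeries.monomial n 1⟩

theorem mon_add (m n : Fin d →₀ ℕ) : mon (m + n) = mon m * mon n :=
  Subtype.ext (by simp [mon, monomial_mul_monomial])

theorem mon_zero : mon (0 : Fin d →₀ ℕ) = 1 := rfl

theorem X_eq_mon (i : Fin d) : (X i : ConvergentPowerSeries d) = mon (Finsupp.single i 1) := rfl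

theorem coe_mul (f g : ConvergentPowerSeries d) : (f * g).1 = f.1 * g.1 := rfl

/-- Membership in a monomial ideal is read off from the support. -/
theorem mem_span_mon {T : Set (Fin d →₀ ℕ)} {f : ConvergentPowerSeries d} :
    f ∈ Ideal.span (mon '' T) ↔ ∀ n, coeff n f.1 ≠ 0 → ∃ t ∈ T, t ≤ n := by
  classical
  constructor
  · intro hf
    induction hf using Submodule.span_induction with
    | mem x hx =>
      obtain ⟨t, ht, rfl⟩ := hx
      intro n hn
      refine ⟨t, ht, ?_⟩
      by_contra hle
      exact hn (coeff_monomial_ne (fun h => hle h.ge) _)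
    | zero => simp
    | add x y _ _ hx hy =>
      intro n hn
      by_cases h : coeff n x.1 = 0
      · refine hy n fun h' => hn ?_
        simp [h, h']
      · exact hx n h
    | smul a x _ hx =>
      intro n hn
      rw [smul_eq_mul, coe_mul, coeff_mul] at hn
      obtain ⟨p, hp, hp0⟩ := Finset.exists_ne_zero_of_sum_ne_zero hn
      obtain ⟨t, ht, htp⟩ := hx p.2 (right_ne_zero_of_mul hp0)
      refine ⟨t, ht, htp.trans ?_⟩
      rw [← Finset.HasAntidiagonal.mem_antidiagonal.mp hp]
      exact le_add_self
  · intro hf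
    -- `T` may be infinite; Dickson's lemma reduces to finitely many exponents, and `f` is cut into
    -- one convergent piece for each.
    obtain ⟨G, hGT, hGfin, hG⟩ := Finsupp.exists_finite_subset_forall_exists_le
      {n | ∃ t ∈ T, t ≤ n}
    have := hGfin.fintype
    have hc : ∀ n, ∃ o : Option G, (∀ i, o = some i → i.1 ≤ n) ∧
        (o = none → coeff n f.1 = 0) := by
      intro n
      by_cases hn : coeff n f.1 = 0
      · exact ⟨none, by simp, fun _ => hn⟩
      · obtain ⟨m, hm, hmn⟩ := hG n (hf n hn)
        exact ⟨some ⟨m, hm⟩, by rintro i ⟨⟩; exact hmn, by simp⟩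
    choose c hc1 hc2 using hc
    have hsum : f = ∑ i : G, mon i.1 *
        (⟨shiftPart (fun n => c n = some i) i.1 f.1, f.2.shiftPart _ _⟩ :
          ConvergentPowerSeries d) := by
      apply Subtype.ext
      ext n
      have h1 : ∀ i : G, coeff n (monomial i.1 1 * shiftPart (fun n => c n = some i) i.1 f.1) =
          if c n = some i then coeff n f.1 else 0 :=
        fun i => by convert coeff_monomial_mul_shiftPart (fun n hn => hc1 n i hn) f.1 n
      simp only [AddSubmonoidClass.coe_finsetSum, map_sum, coe_mul, mon, h1]
      cases hcn : c n with
      | none => simp [hc2 n hcn]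
      | some j => simp
    rw [hsum]
    refine Ideal.sum_mem _ fun i _ => Ideal.mul_mem_right _ _ ?_
    obtain ⟨t, ht, hti⟩ := hGT i.2
    rw [← add_tsub_cancel_of_le hti, mon_add]
    exact Ideal.mul_mem_right _ _ (Ideal.subset_span ⟨t, ht, rfl⟩)

theorem mon_mem_span_mon {T : Set (Fin d →₀ ℕ)} {n : Fin d →₀ ℕ} :
    mon n ∈ Ideal.span (mon '' T) ↔ ∃ t ∈ T, t ≤ n := by
  classical
  rw [mem_span_mon]
  refine ⟨fun h => h n (by simp [mon]), fun h m hm => ?_⟩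
  have : m = n := by
    by_contra hne
    exact hm (coeff_monomial_ne hne _)
  rwa [this]

open scoped Pointwise in
theorem span_mon_mul (T T' : Set (Fin d →₀ ℕ)) :
    Ideal.span (mon '' T) * Ideal.span (mon '' T') = Ideal.span (mon '' (T + T')) := by
  rw [Ideal.span_mul_span']
  congr 1
  ext f
  simp only [Set.mem_mul, Set.mem_image, Set.mem_add]
  constructor
  · rintro ⟨_, ⟨s, hs, rfl⟩, _, ⟨t, ht, rfl⟩, rfl⟩
    exact ⟨_, ⟨s, hs, t, ht, rfl⟩, mon_add _ _⟩
  · rintro ⟨_, ⟨s, hs, t, ht, rfl⟩, rfl⟩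
    exact ⟨_, ⟨s, hs, rfl⟩, _, ⟨t, ht, rfl⟩, (mon_add _ _).symm⟩

open scoped Pointwise in
-- The family `P` stands in for iterated sumsets, so that powers are described by explicit linear
-- conditions on exponents.
theorem span_mon_pow (T : Set (Fin d →₀ ℕ)) (P : ℕ → Set (Fin d →₀ ℕ)) (h0 : P 0 = {0})
    (hs : ∀ k, P (k + 1) = P k + T) (k : ℕ) :
    Ideal.span (mon '' T) ^ k = Ideal.span (mon '' P k) := by
  induction k with
  | zero => simp [h0, mon_zero, Ideal.one_eq_top]
  | succ k ih => rw [pow_succ, ih, span_mon_mul, hs]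

theorem mem_maximalIdeal_iff {f : ConvergentPowerSeries d} :
    f ∈ IsLocalRing.maximalIdeal (ConvergentPowerSeries d) ↔ constantCoeff f.1 = 0 := by
  rw [IsLocalRing.mem_maximalIdeal, mem_nonunits_iff]
  constructor
  · intro h
    by_contra h0
    exact h (isUnit_of_constantCoeff_ne_zero f h0)
  · intro h hu
    have := (hu.map (convergentSubalgebra d).val).map (constantCoeff (σ := Fin d) (R := ℂ))
    exact this.ne_zero h

/-- The prime ideal generated by the variables with index in `S`. -/
noncomputable def varIdeal (S : Set (Fin d)) : Ideal (ConvergentPowerSeries d) :=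
  Ideal.span (mon '' ((fun i => Finsupp.single i 1) '' S))

theorem mem_varIdeal {S : Set (Fin d)} {f : ConvergentPowerSeries d} :
    f ∈ varIdeal S ↔ ∀ n, coeff n f.1 ≠ 0 → ∃ i ∈ S, n i ≠ 0 := by
  rw [varIdeal, mem_span_mon]
  simp [Nat.one_le_iff_ne_zero]

theorem maximalIdeal_eq_varIdeal :
    IsLocalRing.maximalIdeal (ConvergentPowerSeries d) = varIdeal Set.univ := by
  ext f
  rw [mem_maximalIdeal_iff, mem_varIdeal]
  constructor
  · intro h n hn
    by_contra! hz
    have : n = 0 := Finsupp.ext fun i => hz i (Set.mem_univ i)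
    subst this
    exact hn h
  · intro h
    by_contra h0
    obtain ⟨i, -, hi⟩ := h 0 h0
    exact hi rfl

/-- Setting the variables in `S` to zero is a ring homomorphism into a domain with this kernel. It
is multiplicative because a sum of exponents vanishes on `S` only if both summands do. -/
theorem isPrime_varIdeal (S : Set (Fin d)) : (varIdeal S).IsPrime := by
  classical
  have hcoeff : ∀ (f : MvPowerSeries (Fin d) ℂ) n,
      coeff n (shiftPart (fun n => ∀ i ∈ S, n i = 0) 0 f) =
        if ∀ i ∈ S, n i = 0 then coeff n f else 0 := by
    intro f n
    rw [coeff_shiftPart, add_zero]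
    congr
  let ψ : ConvergentPowerSeries d →+* MvPowerSeries (Fin d) ℂ :=
    { toFun := fun f => shiftPart (fun n => ∀ i ∈ S, n i = 0) 0 f.1
      map_one' := by
        ext n
        rw [hcoeff]
        change (if ∀ i ∈ S, n i = 0 then coeff n (1 : MvPowerSeries (Fin d) ℂ) else 0) = _
        rw [coeff_one]
        by_cases hn : n = 0
        · simp [hn]
        · simp [hn]
      map_zero' := by
        ext n
        rw [hcoeff]
        change (if ∀ i ∈ S, n i = 0 then coeff n (0 : MvPowerSeries (Fin d) ℂ) else 0) = _
        simp
      map_add' := fun f g => by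
        ext n
        rw [map_add, hcoeff, hcoeff, hcoeff]
        change (if ∀ i ∈ S, n i = 0 then coeff n (f.1 + g.1) else 0) = _
        split_ifs <;> simp
      map_mul' := fun f g => by
        ext n
        rw [coeff_mul]
        simp only [hcoeff, coe_mul]
        have hp : ∀ p ∈ Finset.HasAntidiagonal.antidiagonal n,
            ((∀ i ∈ S, n i = 0) ↔ (∀ i ∈ S, p.1 i = 0) ∧ (∀ i ∈ S, p.2 i = 0)) := by
          intro p hp
          rw [← Finset.HasAntidiagonal.mem_antidiagonal.mp hp, ← forall₂_and]
          simp
        by_cases hn : ∀ i ∈ S, n i = 0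
        · rw [if_pos hn, coeff_mul]
          refine Finset.sum_congr rfl fun p hpn => ?_
          obtain ⟨h1, h2⟩ := (hp p hpn).mp hn
          rw [if_pos h1, if_pos h2]
        · rw [if_neg hn]
          refine (Finset.sum_eq_zero fun p hpn => ?_).symm
          rw [hp p hpn, not_and_or] at hn
          rcases hn with h | h <;> simp only [if_neg h, zero_mul, mul_zero] }
  have hψ : ∀ f n, coeff n (ψ f) = if ∀ i ∈ S, n i = 0 then coeff n f.1 else 0 :=
    fun f n => hcoeff f.1 n
  have hker : varIdeal S = RingHom.ker ψ := by
    ext f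
    rw [mem_varIdeal, RingHom.mem_ker]
    constructor
    · intro h
      ext n
      rw [hψ]
      split_ifs with hn
      · by_contra h0
        obtain ⟨i, hi, hi0⟩ := h n h0
        exact hi0 (hn i hi)
      · rfl
    · intro h n hn
      by_contra! hz
      have h1 := hψ f n
      rw [if_pos hz, h] at h1
      exact hn h1.symm
  have : IsDomain (MvPowerSeries (Fin d) ℂ) := NoZeroDivisors.to_isDomain _
  rw [hker]
  exact RingHom.ker_isPrime ψ

theorem X_mem_varIdeal {S : Set (Fin d)} {i : Fin d} : X i ∈ varIdeal S ↔ i ∈ S := by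
  rw [X_eq_mon, varIdeal, mon_mem_span_mon]
  constructor
  · rintro ⟨_, ⟨j, hj, rfl⟩, hle⟩
    have : j = i := by
      by_contra hne
      have := hle j
      simp [hne] at this
    rwa [← this]
  · exact fun hi => ⟨_, ⟨i, hi, rfl⟩, le_rfl⟩

theorem varIdeal_le {S : Set (Fin d)} {I : Ideal (ConvergentPowerSeries d)} :
    varIdeal S ≤ I ↔ ∀ i ∈ S, X i ∈ I := by
  rw [varIdeal, Ideal.span_le, ← Set.image_comp, Set.image_subset_iff]
  rfl

/-- The ideal generated by `k` of the variables has height `k`. -/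
theorem height_varIdeal (S : Finset (Fin d)) :
    (varIdeal (S : Set (Fin d))).height = S.card := by
  classical
  have hprime := fun S => isPrime_varIdeal (d := d) S
  apply le_antisymm
  -- Upper bound by Krull's height theorem; the lower bound adds one variable at a time to build a
  -- strict chain of primes.
  · refine (Ideal.height_le_spanFinrank _ (hprime _).ne_top).trans ?_
    have h : (mon '' ((fun i : Fin d => Finsupp.single i 1) '' (S : Set (Fin d)))).Finite :=
      (S.finite_toSet.image _).image _
    refine Nat.cast_le.mpr ((Submodule.spanFinrank_span_le_ncard_of_finite h).trans ?_)
    exact ((Set.ncard_image_le (S.finite_toSet.image _)).trans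
        ((Set.ncard_image_le S.finite_toSet).trans_eq (Set.ncard_coe_finset S)))
  · induction S using Finset.induction_on with
    | empty => simp
    | insert i S hi ih =>
      rw [Finset.card_insert_of_notMem hi, Nat.cast_add, Nat.cast_one]
      refine le_trans (add_le_add_left ih 1)
        (Ideal.height_add_one_le_of_lt_of_isPrime (lt_of_le_of_ne ?_ fun h => ?_))
      · exact varIdeal_le.mpr fun j hj => X_mem_varIdeal.mpr (by simp_all)
      · have : X i ∈ varIdeal (S : Set (Fin d)) := by
          rw [h]; exact X_mem_varIdeal.mpr (by simp)
        exact hi (by simpa using X_mem_varIdeal.mp this)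

theorem ringKrullDim_eq (d : ℕ) : ringKrullDim (ConvergentPowerSeries d) = d := by
  rw [← IsLocalRing.maximalIdeal_height_eq_ringKrullDim, maximalIdeal_eq_varIdeal]
  have := height_varIdeal (Finset.univ : Finset (Fin d))
  rw [Finset.coe_univ] at this
  rw [this]
  simp

/-! ### The Hilbert function of a monomial ideal as a count -/

open IsLocalRing in
/-- The Hilbert function at a monomial ideal `M`, when `S` is the set of exponents of `M` that are
not exponents of `𝔪 M`. -/
theorem mixedHilbertFunction_eq_card {s : ℕ} (J : Fin s → Ideal (ConvergentPowerSeries d))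
    (w : Fin (s + 1) → ℕ) (T T' : Set (Fin d →₀ ℕ)) (S : Finset (Fin d →₀ ℕ))
    (hM : mixedPower J w = Ideal.span (mon '' T))
    (hm : maximalIdeal (ConvergentPowerSeries d) * Ideal.span (mon '' T) = Ideal.span (mon '' T'))
    (hS : ∀ n, n ∈ S ↔ (∃ t ∈ T, t ≤ n) ∧ ¬ ∃ t ∈ T', t ≤ n) :
    mixedHilbertFunction J w = S.card := by
  classical
  rw [← hM] at hm
  have hmem : ∀ f, f ∈ mixedPower J w ↔ ∀ n, coeff n f.1 ≠ 0 → ∃ t ∈ T, t ≤ n :=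
    fun f => by rw [hM, mem_span_mon]
  have hmon : ∀ n, mon n ∈ mixedPower J w ↔ ∃ t ∈ T, t ≤ n :=
    fun n => by rw [hM, mon_mem_span_mon]
  let φ : mixedPower J w →ₗ[ℂ] (S → ℂ) :=
    { toFun := fun f n => coeff n.1 f.1.1
      map_add' := fun f g => rfl
      map_smul' := fun a f => rfl }
  have hφsurj : Function.Surjective φ := by
    intro v
    have hmem : ∀ n : S, mon n.1 ∈ mixedPower J w := fun n => (hmon _).mpr ((hS n.1).mp n.2).1
    refine ⟨∑ n : S, v n • ⟨mon n.1, hmem n⟩, ?_⟩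
    rw [map_sum]
    ext k
    rw [Finset.sum_apply, Finset.sum_eq_single k]
    · rw [map_smul, Pi.smul_apply]
      change v k • coeff k.1 (monomial k.1 (1 : ℂ)) = v k
      simp
    · intro n _ hnk
      rw [map_smul, Pi.smul_apply]
      change v n • coeff k.1 (monomial n.1 (1 : ℂ)) = 0
      rw [coeff_monomial_ne (fun h => hnk (Subtype.ext h.symm)), smul_zero]
    · simp
  have hker : ∀ f : mixedPower J w, φ f = 0 ↔ (f : ConvergentPowerSeries d) ∈
      maximalIdeal (ConvergentPowerSeries d) * mixedPower J w := by
    intro f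
    rw [hm, mem_span_mon]
    constructor
    · intro h n hn
      by_contra hcon
      have hnS : n ∈ S := (hS n).mpr ⟨(hmem _).mp f.2 n hn, hcon⟩
      exact hn (congrFun h ⟨n, hnS⟩)
    · intro h
      ext n
      by_contra hn
      exact ((hS n.1).mp n.2).2 (h n.1 hn)
  have hφsmul : ∀ (a : ConvergentPowerSeries d) (f : mixedPower J w),
      φ (a • f) = constantCoeff a.1 • φ f := by
    intro a f
    ext n
    change coeff n.1 (a.1 * f.1.1) = constantCoeff a.1 * coeff n.1 f.1.1
    rw [coeff_mul, Finset.sum_eq_single (0, n.1)]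
    · simp
    · intro p hp hne
      by_contra hp0
      have hp' := Finset.HasAntidiagonal.mem_antidiagonal.mp hp
      obtain ⟨t, ht, htp⟩ := (hmem _).mp f.2 p.2 (right_ne_zero_of_mul hp0)
      have hp1 : p.1 ≠ 0 := by
        intro h0
        apply hne
        rw [h0, zero_add] at hp'
        exact Prod.ext h0 hp'
      -- A nonconstant term of `a` times a term of `f` would put `n` among the exponents of `𝔪M`, so
      -- only the constant term of `a` acts.
      have h1 : mon n.1 ∈ maximalIdeal (ConvergentPowerSeries d) * mixedPower J w := by
        rw [← hp', mon_add]
        refine Ideal.mul_mem_mul ?_ ((hmon _).mpr ⟨t, ht, htp⟩)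
        rw [mem_maximalIdeal_iff, ← coeff_zero_eq_constantCoeff_apply]
        exact coeff_monomial_ne (Ne.symm hp1) _
      rw [hm] at h1
      exact ((hS n.1).mp n.2).2 (mon_mem_span_mon.mp h1)
    · simp
  refine (finrank_quotient_maximalIdeal_smul (mixedPower J w) φ hφsurj hker
    ((constantCoeff (σ := Fin d) (R := ℂ)).comp (convergentSubalgebra d).val.toRingHom)
    (fun a ha => mem_maximalIdeal_iff.mp ha)
    (fun c => ⟨algebraMap ℂ _ c, constantCoeff_C (σ := Fin d) c⟩) hφsmul).trans (by simp)

end ConvergentPowerSeries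

/-! ### Exponents of the products of ideals in three variables -/

/-- The exponent `(p, q, r)`. -/
noncomputable def expo (p q r : ℕ) : Fin 3 →₀ ℕ := Finsupp.equivFunOnFinite.symm ![p, q, r]

section expo

@[simp] theorem expo_zero (p q r : ℕ) : expo p q r 0 = p := rfl
@[simp] theorem expo_one (p q r : ℕ) : expo p q r 1 = q := rfl
@[simp] theorem expo_two (p q r : ℕ) : expo p q r 2 = r := rfl

theorem expo_ext_iff {m n : Fin 3 →₀ ℕ} : m = n ↔ m 0 = n 0 ∧ m 1 = n 1 ∧ m 2 = n 2 := by
  rw [Finsupp.ext_iff, Fin.forall_fin_succ, Fin.forall_fin_succ, Fin.forall_fin_succ]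
  simp

theorem expo_le_iff {m n : Fin 3 →₀ ℕ} : m ≤ n ↔ m 0 ≤ n 0 ∧ m 1 ≤ n 1 ∧ m 2 ≤ n 2 := by
  rw [Finsupp.le_def, Fin.forall_fin_succ, Fin.forall_fin_succ, Fin.forall_fin_succ]
  simp

end expo

/-- The exponents of degree `u`, which generate the `u`-th power of `(x, y, z)`. -/
def degExponents (u : ℕ) : Set (Fin 3 →₀ ℕ) := {n | n 0 + n 1 + n 2 = u}

/-- The exponents of the products of `a` elements of `{xy², y³z, xzᶜ}`. -/
def idealExponents (c a : ℕ) : Set (Fin 3 →₀ ℕ) :=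
  {n | ∃ i j k, i + j + k = a ∧ n 0 = i + k ∧ n 1 = 2 * i + 3 * j ∧ n 2 = j + c * k}

section exponents
open scoped Pointwise

theorem degExponents_succ (u : ℕ) : degExponents (u + 1) = degExponents u + degExponents 1 := by
  ext n
  simp only [degExponents, Set.mem_add, Set.mem_ofPred_eq]
  constructor
  · intro h
    rcases Nat.eq_zero_or_pos (n 0) with h0 | h0
    · rcases Nat.eq_zero_or_pos (n 1) with h1 | h1
      · exact ⟨expo (n 0) (n 1) (n 2 - 1), by simp; omega, expo 0 0 1, by simp,
          by rw [expo_ext_iff]; simp; omega⟩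
      · exact ⟨expo (n 0) (n 1 - 1) (n 2), by simp; omega, expo 0 1 0, by simp,
          by rw [expo_ext_iff]; simp; omega⟩
    · exact ⟨expo (n 0 - 1) (n 1) (n 2), by simp; omega, expo 1 0 0, by simp,
        by rw [expo_ext_iff]; simp; omega⟩
  · rintro ⟨s, hs, t, ht, rfl⟩
    simp only [Finsupp.add_apply]
    omega

theorem idealExponents_succ (c a : ℕ) :
    idealExponents c (a + 1) = idealExponents c a + idealExponents c 1 := by
  ext n
  simp only [idealExponents, Set.mem_add, Set.mem_ofPred_eq]
  constructor
  · rintro ⟨i, j, k, hs, h0, h1, h2⟩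
    rcases i with _ | i
    · rcases j with _ | j
      · rcases k with _ | k
        · omega
        · exact ⟨expo k 0 (c * k), ⟨0, 0, k, by simp; omega⟩, expo 1 0 c, ⟨0, 0, 1, by simp⟩,
            by rw [expo_ext_iff]; simp [h0, h1, h2, mul_add]⟩
      · exact ⟨expo k (3 * j) (j + c * k), ⟨0, j, k, by simp; omega⟩, expo 0 3 1,
          ⟨0, 1, 0, by simp⟩, by rw [expo_ext_iff]; simp [h0, h1, h2]; omega⟩
    · exact ⟨expo (i + k) (2 * i + 3 * j) (j + c * k), ⟨i, j, k, by simp; omega⟩, expo 1 2 0,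
        ⟨1, 0, 0, by simp⟩, by rw [expo_ext_iff]; simp [h0, h1, h2]; omega⟩
  · rintro ⟨s, ⟨i, j, k, hs, h0, h1, h2⟩, t, ⟨i', j', k', hs', h0', h1', h2'⟩, rfl⟩
    refine ⟨i + i', j + j', k + k', by omega, ?_⟩
    simp only [Finsupp.add_apply, mul_add]
    omega

theorem degExponents_zero : degExponents 0 = {0} := by
  ext n
  simp only [degExponents, Set.mem_ofPred_eq, Set.mem_singleton_iff, expo_ext_iff (n := 0),
    Finsupp.coe_zero, Pi.zero_apply]
  omega

theorem idealExponents_zero (c : ℕ) : idealExponents c 0 = {0} := by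
  ext n
  simp only [idealExponents, Set.mem_ofPred_eq, Set.mem_singleton_iff, expo_ext_iff (n := 0),
    Finsupp.coe_zero, Pi.zero_apply]
  constructor
  · rintro ⟨i, j, k, hs, h0, h1, h2⟩
    obtain rfl : k = 0 := by omega
    omega
  · rintro ⟨h0, h1, h2⟩
    exact ⟨0, 0, 0, by simp [h0, h1, h2]⟩

end exponents

/-- The exponents whose monomials generate `𝔪^u J₁^a J₂^b`. -/
def mixedExponents (u a b : ℕ) : Set (Fin 3 →₀ ℕ) :=
  open scoped Pointwise in degExponents u + (idealExponents 1 a + idealExponents 2 b)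

/-! ### Least degrees of generators and their enumeration -/

/-- Among the generators of `J₁^a J₂^b` that divide `x^p y^q z^r`, one of minimal degree is found
explicitly. -/
theorem exists_generator_iff (u a b p q r : ℕ) :
    (∃ i j k i' j' k', i + j + k = a ∧ i' + j' + k' = b ∧ i + k + (i' + k') ≤ p ∧
      2 * i + 3 * j + (2 * i' + 3 * j') ≤ q ∧ j + k + (j' + 2 * k') ≤ r ∧
      3 * i + 4 * j + 2 * k + (3 * i' + 4 * j' + 3 * k') + u ≤ p + q + r) ↔
    ((a + b - p) ≤ r ∧ 3 * (a + b - p) ≤ q ∧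
      2 * (a + b) + (a + b - p) ≤
        q + 2 * min a (min (a + b - (a + b - p)) (r - (a + b - p))) + 2 * b ∧
      2 * (a + b) + (a + b - p) ≤ q + 2 * ((r - (a + b - p) +
        min a (min (a + b - (a + b - p)) (r - (a + b - p)))) / 2)) ∧
      3 * (a + b) + (a + b - p) + u ≤
        p + q + r + min a (min (a + b - (a + b - p)) (r - (a + b - p))) := by
  obtain ⟨J, hJ⟩ : ∃ J, J = a + b - p := ⟨_, rfl⟩
  rw [← hJ]
  -- With `J` factors `y³z`, at most `K` factors `xz` fit: the bounds are the `a` factors of `J₁`,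
  -- the remaining factors, and the room left in the `z`-exponent. The least degree is `3(a+b) + J -
  -- K`.
  obtain ⟨K, hK⟩ : ∃ K, K = min a (min (a + b - J) (r - J)) := ⟨_, rfl⟩
  rw [← hK]
  constructor
  · rintro ⟨i, j, k, i', j', k', ha, hb, hp, hq, hr, hd⟩
    have h1 : J ≤ j + j' := by omega
    have h2 : k ≤ K + (j + j' - J) := by omega
    have h3 : K + J ≤ r := by omega
    refine ⟨⟨by omega, by omega, ?_, ?_⟩, by omega⟩
    · omega
    · omega
  · rintro ⟨⟨h1, h2, h3, h4⟩, h5⟩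
    -- `M` counts the factors `xz` and `xz²` together. The `y`-exponent is then `2(a+b) + J - 2M`,
    -- so `M` is the least value at least `K` that brings it down to `q`.
    obtain ⟨M, hM⟩ : ∃ M, M = max K ((2 * (a + b) + J - q + 1) / 2) := ⟨_, rfl⟩
    -- As many factors `y³z` as possible are taken from `J₁`, after its `K` factors `xz`.
    obtain ⟨j, hj⟩ : ∃ j, j = min J (a - K) := ⟨_, rfl⟩
    have h6 : K ≤ a := by omega
    have h7 : M ≤ a + b - J := by omega
    have h8 : M ≤ K + b := by omega
    have h9 : 2 * M ≤ r - J + K := by omega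
    have h10 : J ≤ a + b := by omega
    have h11 : (J - j) + (M - K) ≤ b := by omega
    exact ⟨a - K - j, j, K, b - (M - K) - (J - j), J - j, M - K, by omega, by omega, by omega,
      by omega, by omega, by omega⟩

/-- Once a generator of `J₁^a J₂^b` divides the monomial, a factor of degree `u` fits into the
quotient exactly when its degree allows it. -/
theorem exists_mem_mixedExponents_le_iff (u a b : ℕ) (n : Fin 3 →₀ ℕ) :
    (∃ t ∈ mixedExponents u a b, t ≤ n) ↔
    ∃ i j k i' j' k', i + j + k = a ∧ i' + j' + k' = b ∧ i + k + (i' + k') ≤ n 0 ∧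
      2 * i + 3 * j + (2 * i' + 3 * j') ≤ n 1 ∧ j + k + (j' + 2 * k') ≤ n 2 ∧
      3 * i + 4 * j + 2 * k + (3 * i' + 4 * j' + 3 * k') + u ≤ n 0 + n 1 + n 2 := by
  simp only [mixedExponents, Set.mem_add, degExponents, idealExponents, Set.mem_ofPred_eq]
  constructor
  · rintro ⟨_, ⟨s, hs, _, ⟨t, ⟨i, j, k, h⟩, t', ⟨i', j', k', h'⟩, rfl⟩, rfl⟩, hle⟩
    rw [expo_le_iff] at hle
    simp only [Finsupp.add_apply] at hle
    exact ⟨i, j, k, i', j', k', by omega⟩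
  · rintro ⟨i, j, k, i', j', k', ha, hb, h0, h1, h2, hd⟩
    obtain ⟨s0, s1, s2, hs, hs0, hs1, hs2⟩ : ∃ s0 s1 s2, s0 + s1 + s2 = u ∧
        s0 + (i + k + (i' + k')) ≤ n 0 ∧ s1 + (2 * i + 3 * j + (2 * i' + 3 * j')) ≤ n 1 ∧
        s2 + (j + k + (j' + 2 * k')) ≤ n 2 := by
      -- Greedy choice: fill the `x`-exponent, then the `y`-exponent, then the `z`-exponent.
      obtain ⟨s0, hs0⟩ : ∃ s, s = min u (n 0 - (i + k + (i' + k'))) := ⟨_, rfl⟩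
      obtain ⟨s1, hs1⟩ : ∃ s, s = min (u - s0) (n 1 - (2 * i + 3 * j + (2 * i' + 3 * j'))) :=
        ⟨_, rfl⟩
      exact ⟨s0, s1, u - s0 - s1, by omega, by omega, by omega, by omega⟩
    refine ⟨_, ⟨expo s0 s1 s2, hs, _,
      ⟨expo (i + k) (2 * i + 3 * j) (j + k), ⟨i, j, k, by simp; omega⟩,
       expo (i' + k') (2 * i' + 3 * j') (j' + 2 * k'), ⟨i', j', k', by simp; omega⟩, rfl⟩, rfl⟩, ?_⟩
    rw [expo_le_iff]
    simp only [Finsupp.add_apply, expo_zero, expo_one, expo_two]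
    omega

/-- The exponents of the minimal generators of `𝔪^u J₁^a J₂^b`. -/
noncomputable def minimalExponents (u a b : ℕ) : Finset (ℕ × ℕ × ℕ) :=
  ((Finset.range (a + b)).sigma fun m => Finset.range (2 * m + u + 1 - min a m)).image
    (fun x => (x.1, 3 * (a + b - x.1) + (2 * x.1 + u) - min a (min x.1 x.2) - x.2,
      x.2 + (a + b - x.1))) ∪
  ((Finset.range a ×ˢ Finset.range (u + 1)).image
    (fun x => (a + b + (u - x.2), 2 * (a + b - x.1) + x.2, x.1)) ∪
  ((Finset.range (b + 1)).image (fun e => (a + b + u, 2 * e, a + (2 * b - 2 * e))) ∪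
  ((Finset.range u).sigma fun s => Finset.range (2 * b + s + 2)).image
    (fun x => (a + b + (u - 1 - x.1), x.2, a + (2 * b + x.1 + 1 - x.2)))))

/-- The four families are the cases `p < a+b`; `p ≥ a+b` with `r < a`; and `p ≥ a+b`, `r ≥ a` with
`q + (r-a)` equal to or larger than `2b`. In each case the degree equation fixes one coordinate. The
bound `1 ≤ u` absorbs the rounding in the halved term when `p < a+b`. -/
theorem mem_minimalExponents {u a b p q r : ℕ} (hu : 1 ≤ u) :
    (p, q, r) ∈ minimalExponents u a b ↔
    ((a + b - p) ≤ r ∧ 3 * (a + b - p) ≤ q ∧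
      2 * (a + b) + (a + b - p) ≤
        q + 2 * min a (min (a + b - (a + b - p)) (r - (a + b - p))) + 2 * b ∧
      2 * (a + b) + (a + b - p) ≤ q + 2 * ((r - (a + b - p) +
        min a (min (a + b - (a + b - p)) (r - (a + b - p)))) / 2)) ∧
      3 * (a + b) + (a + b - p) + u =
        p + q + r + min a (min (a + b - (a + b - p)) (r - (a + b - p))) := by
  simp only [minimalExponents, Finset.mem_union, Finset.mem_image, Finset.mem_sigma,
    Finset.mem_product, Finset.mem_range, Prod.mk.injEq, Sigma.exists, Prod.exists]
  constructor
  · rintro (⟨m, t, ⟨hm, ht⟩, rfl, rfl, rfl⟩ | ⟨s, t, ⟨hs, ht⟩, rfl, rfl, rfl⟩ |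
      ⟨e, he, rfl, rfl, rfl⟩ | ⟨s, t, ⟨hs, ht⟩, rfl, rfl, rfl⟩)
    · omega
    · omega
    · omega
    · omega
  · rintro ⟨⟨h1, h2, h3, h4⟩, h5⟩
    by_cases hp : p < a + b
    · left
      exact ⟨p, r - (a + b - p), by omega⟩
    · right
      have hz : a + b - p = 0 := by omega
      rw [hz] at h1 h2 h3 h4 h5
      by_cases hr : r < a
      · left
        exact ⟨r, q - 2 * (a + b - r), by omega⟩
      · right
        -- In the equality case the halved term admits no rounding loss, so `q` is even; otherwise
        -- the excess over `2b` is at least `1`, whence the shift by one.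
        by_cases hs : q + (r - a) = 2 * b
        · left
          exact ⟨q / 2, by omega⟩
        · right
          exact ⟨q + (r - a) - 2 * b - 1, q, by omega⟩

/-- The families are disjoint and injectively parametrised, so their sizes add. Doubling, and moving
the negative terms to the left, keeps the identity in `ℕ`. -/
theorem two_mul_card_minimalExponents (u a b : ℕ) :
    2 * (minimalExponents u a b).card + a + 4 * b =
      (u + 1) * (u + 2) + 2 * (2 * a + 3 * b) * (u + 1) + a ^ 2 + 2 * a * b + 2 * b ^ 2 := by
  rw [minimalExponents, Finset.card_union_of_disjoint, Finset.card_union_of_disjoint,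
    Finset.card_union_of_disjoint, Finset.card_image_of_injOn, Finset.card_image_of_injOn,
    Finset.card_image_of_injOn, Finset.card_image_of_injOn]
  · simp only [Finset.card_sigma, Finset.card_product, Finset.card_range]
    have h1 : ∀ v, 2 * ∑ s ∈ Finset.range v, (2 * b + s + 2) + v = 4 * b * v + v * v + 4 * v := by
      intro v
      induction v with
      | zero => simp
      | succ v ih => rw [Finset.sum_range_succ]; linarith
    have h2 : ∀ v, v ≤ a → 2 * ∑ m ∈ Finset.range v, (2 * m + u + 1 - min a m) + v =
        v * v + 2 * v * (u + 1) := by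
      intro v
      induction v with
      | zero => simp
      | succ v ih =>
        intro hv
        rw [Finset.sum_range_succ, min_eq_right (by omega : v ≤ a),
          show 2 * v + u + 1 - v = v + u + 1 by omega]
        linarith [ih (by omega)]
    -- The sum is split at `a`, where `min a m` changes from `m` to `a`.
    have h3 : ∀ v, ∑ m ∈ Finset.range (a + v), (2 * m + u + 1 - min a m) + v =
        ∑ m ∈ Finset.range a, (2 * m + u + 1 - min a m) + v * (a + u + 1) + v * v := by
      intro v
      induction v with
      | zero => simp
      | succ v ih =>
        rw [show a + (v + 1) = a + v + 1 from rfl, Finset.sum_range_succ, min_eq_left (by omega : a ≤ a + v),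
          show 2 * (a + v) + u + 1 - a = a + 2 * v + u + 1 by omega]
        linarith
    nlinarith [h1 u, h2 a le_rfl, h3 b]
  · rintro ⟨s, t⟩ h ⟨s', t'⟩ h' heq
    simp only [Finset.coe_sigma, Set.mem_sigma_iff, Finset.coe_range, Set.mem_Iio,
      Prod.mk.injEq] at h h' heq
    obtain rfl : s = s' := by omega
    obtain rfl : t = t' := by omega
    rfl
  · rintro e h e' h' heq
    simp only [Prod.mk.injEq] at heq
    omega
  · rintro ⟨s, t⟩ h ⟨s', t'⟩ h' heq
    simp only [Finset.coe_product, Set.mem_prod, Finset.coe_range, Set.mem_Iio,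
      Prod.mk.injEq] at h h' heq
    obtain rfl : s = s' := by omega
    obtain rfl : t = t' := by omega
    rfl
  · rintro ⟨s, t⟩ h ⟨s', t'⟩ h' heq
    simp only [Finset.coe_sigma, Set.mem_sigma_iff, Finset.coe_range, Set.mem_Iio,
      Prod.mk.injEq] at h h' heq
    obtain rfl : s = s' := by omega
    obtain rfl : t = t' := by omega
    rfl
  all_goals
    rw [Finset.disjoint_left]
    rintro ⟨p, q, r⟩ h h'
    simp only [Finset.mem_union, Finset.mem_image, Finset.mem_sigma,
      Finset.mem_product, Finset.mem_range, Prod.mk.injEq, Sigma.exists, Prod.exists] at h h'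
    omega

/-! ### The Hilbert function of `𝔪^u J₁^a J₂^b` -/

namespace ConvergentPowerSeries

open IsLocalRing in
theorem maximalIdeal_eq_span_degExponents :
    maximalIdeal (ConvergentPowerSeries 3) = Ideal.span (mon '' degExponents 1) := by
  rw [maximalIdeal_eq_varIdeal, varIdeal]
  congr 2
  ext n
  simp only [degExponents, Set.mem_image, Set.mem_univ, true_and, Set.mem_ofPred_eq]
  constructor
  · rintro ⟨i, rfl⟩
    fin_cases i <;> simp
  · intro h
    rcases Nat.eq_zero_or_pos (n 0) with h0 | h0
    · rcases Nat.eq_zero_or_pos (n 1) with h1 | h1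
      · exact ⟨2, by rw [expo_ext_iff]; simp; omega⟩
      · exact ⟨1, by rw [expo_ext_iff]; simp; omega⟩
    · exact ⟨0, by rw [expo_ext_iff]; simp; omega⟩

theorem span_eq_span_idealExponents (c : ℕ) :
    Ideal.span {(X 0 * X 1 ^ 2 : ConvergentPowerSeries 3), X 1 ^ 3 * X 2, X 0 * X 2 ^ c} =
      Ideal.span (mon '' idealExponents c 1) := by
  have hX : ∀ (i : Fin 3) (k : ℕ), (X i : ConvergentPowerSeries 3) ^ k =
      mon (Finsupp.single i k) := by
    intro i k
    induction k with
    | zero => simp [mon_zero]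
    | succ k ih => rw [pow_succ, ih, Finsupp.single_add, mon_add, X_eq_mon]
  have h : idealExponents c 1 = {expo 1 2 0, expo 0 3 1, expo 1 0 c} := by
    ext n
    simp only [idealExponents, Set.mem_ofPred_eq, Set.mem_insert_iff, Set.mem_singleton_iff]
    constructor
    · rintro ⟨i, j, k, h, h0, h1, h2⟩
      obtain ⟨rfl, rfl, rfl⟩ | ⟨rfl, rfl, rfl⟩ | ⟨rfl, rfl, rfl⟩ :
        (i = 1 ∧ j = 0 ∧ k = 0) ∨ (i = 0 ∧ j = 1 ∧ k = 0) ∨ (i = 0 ∧ j = 0 ∧ k = 1) := by omega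
      · left; rw [expo_ext_iff]; simp [h0, h1, h2]
      · right; left; rw [expo_ext_iff]; simp [h0, h1, h2]
      · right; right; rw [expo_ext_iff]; simp [h0, h1, h2]
    · rintro (rfl | rfl | rfl)
      · exact ⟨1, 0, 0, by simp⟩
      · exact ⟨0, 1, 0, by simp⟩
      · exact ⟨0, 0, 1, by simp⟩
  rw [h, Set.image_insert_eq, Set.image_pair, hX, hX, hX,
    show (X 0 : ConvergentPowerSeries 3) = X 0 ^ 1 from (pow_one _).symm,
    show (X 2 : ConvergentPowerSeries 3) = X 2 ^ 1 from (pow_one _).symm, hX, hX,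
    ← mon_add, ← mon_add, ← mon_add]
  congr <;> rw [expo_ext_iff] <;> simp

open IsLocalRing in
theorem mul_pow_mul_pow_eq_span (u a b : ℕ) :
    maximalIdeal (ConvergentPowerSeries 3) ^ u *
      (Ideal.span (mon '' idealExponents 1 1) ^ a * Ideal.span (mon '' idealExponents 2 1) ^ b) =
    Ideal.span (mon '' mixedExponents u a b) := by
  rw [maximalIdeal_eq_span_degExponents,
    span_mon_pow _ degExponents degExponents_zero degExponents_succ,
    span_mon_pow _ (idealExponents 1) (idealExponents_zero 1) (idealExponents_succ 1),
    span_mon_pow _ (idealExponents 2) (idealExponents_zero 2) (idealExponents_succ 2),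
    span_mon_mul, span_mon_mul, mixedExponents]

open IsLocalRing in
/-- The Hilbert function at `𝔪^u J₁^a J₂^b`. -/
theorem two_mul_mixedHilbertFunction {s : ℕ} (J : Fin s → Ideal (ConvergentPowerSeries 3))
    (w : Fin (s + 1) → ℕ) (u a b : ℕ) (hu : 1 ≤ u)
    (hJ : mixedPower J w = maximalIdeal (ConvergentPowerSeries 3) ^ u *
      (Ideal.span (mon '' idealExponents 1 1) ^ a *
        Ideal.span (mon '' idealExponents 2 1) ^ b)) :
    2 * mixedHilbertFunction J w + a + 4 * b =
      (u + 1) * (u + 2) + 2 * (2 * a + 3 * b) * (u + 1) + a ^ 2 + 2 * a * b + 2 * b ^ 2 := by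
  classical
  rw [← two_mul_card_minimalExponents]
  let e : ℕ × ℕ × ℕ ↪ (Fin 3 →₀ ℕ) :=
    ⟨fun x => expo x.1 x.2.1 x.2.2, by
      rintro ⟨p, q, r⟩ ⟨p', q', r'⟩ h
      rw [expo_ext_iff] at h
      simpa using h⟩
  rw [mixedHilbertFunction_eq_card J w (mixedExponents u a b) (mixedExponents (u + 1) a b)
    ((minimalExponents u a b).map e) (hJ.trans (mul_pow_mul_pow_eq_span u a b)),
    Finset.card_map]
  · rw [← mul_pow_mul_pow_eq_span, ← mul_pow_mul_pow_eq_span, pow_succ', mul_assoc]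
  · intro n
    have hn : n ∈ (minimalExponents u a b).map e ↔ (n 0, n 1, n 2) ∈ minimalExponents u a b := by
      rw [Finset.mem_map]
      constructor
      · rintro ⟨⟨p, q, r⟩, hx, rfl⟩
        exact hx
      · exact fun h => ⟨_, h, by rw [expo_ext_iff]; exact ⟨rfl, rfl, rfl⟩⟩
    -- Only the degree inequality involves `u`; holding for `u` and failing for `u + 1` turns it
    -- into an equality.
    rw [hn, mem_minimalExponents hu, exists_mem_mixedExponents_le_iff,
      exists_mem_mixedExponents_le_iff, exists_generator_iff, exists_generator_iff]
    constructor
    · rintro ⟨h1, h2⟩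
      exact ⟨⟨h1, h2.le⟩, fun h => by omega⟩
    · rintro ⟨⟨h1, h2⟩, h3⟩
      exact ⟨h1, le_antisymm (by by_contra hlt; exact h3 ⟨h1, by omega⟩) h2 |>.symm⟩

end ConvergentPowerSeries

/-! ### Mixed multiplicities, heights and the counterexample -/

/-- A Hilbert function given by a quadratic polynomial determines the mixed multiplicity. -/
theorem hasMixedMultiplicity_of_quadratic {A : Type*} [CommRing A] [IsLocalRing A]
    (J : Fin 2 → Ideal A) (e : ℕ) (c₀ c₁ c₂ c₁₁ c₂₂ l₀ l₁ l₂ k : ℚ) (hc₀ : c₀ ≠ 0)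
    (h : ∀ w : Fin 3 → ℕ, (∀ j, 1 ≤ w j) → (mixedHilbertFunction J w : ℚ) =
      c₀ * w 0 ^ 2 + c₁ * (w 0 * w 1) + c₂ * (w 0 * w 2) + c₁₁ * w 1 ^ 2 + e * (w 1 * w 2) +
        c₂₂ * w 2 ^ 2 + l₀ * w 0 + l₁ * w 1 + l₂ * w 2 + k) :
    HasMixedMultiplicity J ![0, 1, 1] e := by
  classical
  let E : Fin 10 → (Fin 3 →₀ ℕ) := ![expo 2 0 0, expo 1 1 0, expo 1 0 1, expo 0 2 0, expo 0 1 1,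
    expo 0 0 2, expo 1 0 0, expo 0 1 0, expo 0 0 1, expo 0 0 0]
  let C : Fin 10 → ℚ := ![c₀, c₁, c₂, c₁₁, e, c₂₂, l₀, l₁, l₂, k]
  have hcoeff : ∀ i j : Fin 10, MvPolynomial.coeff (E i) (MvPolynomial.monomial (E j) (C j)) =
      if i = j then C j else 0 := by
    intro i j
    rw [MvPolynomial.coeff_monomial]
    congr 1
    rw [expo_ext_iff, eq_iff_iff]
    fin_cases i <;> fin_cases j <;> simp [E]
  have hcoeff' : ∀ i, MvPolynomial.coeff (E i) (∑ j, MvPolynomial.monomial (E j) (C j)) = C i := by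
    intro i
    simp only [MvPolynomial.coeff_sum, hcoeff]
    simp
  refine ⟨∑ j, MvPolynomial.monomial (E j) (C j), ⟨1, fun w hw => ?_⟩, ?_, ?_⟩
  · have heval : ∀ j, MvPolynomial.eval (fun j => (w j : ℚ)) (MvPolynomial.monomial (E j) (C j)) =
        C j * ((w 0 : ℚ) ^ E j 0 * (w 1 : ℚ) ^ E j 1 * (w 2 : ℚ) ^ E j 2) := by
      intro j
      rw [MvPolynomial.eval_monomial, Finsupp.prod_fintype _ _ fun _ => pow_zero _]
      exact congrArg _ (Fin.prod_univ_three _)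
    rw [h w hw, map_sum]
    simp only [heval]
    simp [Fin.sum_univ_succ, E, C]
    ring
  · have hdeg : ∀ i, (E i).degree ≤ 2 := by
      intro i
      rw [Finsupp.degree_eq_sum, Fin.sum_univ_three]
      fin_cases i <;> simp [E]
    rw [show ∑ j, (![0, 1, 1] : Fin 3 → ℕ) j = 2 by simp [Fin.sum_univ_three]]
    apply le_antisymm
    · refine MvPolynomial.totalDegree_finsetSum_le fun j _ => ?_
      exact (MvPolynomial.totalDegree_monomial_le _ _).trans (hdeg j)
    -- The nonzero coefficient of `u²` makes the total degree exactly `2`.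
    · have h0 : E 0 ∈ (∑ j, MvPolynomial.monomial (E j) (C j)).support := by
        rw [MvPolynomial.mem_support_iff, hcoeff']
        exact hc₀
      refine le_trans ?_ (MvPolynomial.le_totalDegree h0)
      rw [Finsupp.sum_fintype _ _ (fun _ => rfl), Fin.sum_univ_three]
      simp [E]
  · exact (hcoeff' 4).trans (by simp [C, Fin.prod_univ_three])

namespace ConvergentPowerSeries

/-- The ideals `(xy², y³z, xzᶜ)` have height two. -/
theorem height_span_eq_two {c : ℕ} (hc : c ≠ 0) :
    (Ideal.span {(X 0 * X 1 ^ 2 : ConvergentPowerSeries 3), X 1 ^ 3 * X 2,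
      X 0 * X 2 ^ c}).height = 2 := by
  have hpair : ∀ i j : Fin 3, i ≠ j → (varIdeal {i, j}).height = 2 := by
    intro i j hij
    have := height_varIdeal {i, j}
    rwa [Finset.card_pair hij, Finset.coe_pair] at this
  apply le_antisymm
  -- All three generators lie in the prime `(x, y)` of height two.
  · refine le_trans (Ideal.height_mono ?_) (hpair 0 1 (by decide)).le
    have h0 : (X 0 : ConvergentPowerSeries 3) ∈ varIdeal {0, 1} := X_mem_varIdeal.mpr (by simp)
    have h1 : (X 1 : ConvergentPowerSeries 3) ∈ varIdeal {0, 1} := X_mem_varIdeal.mpr (by simp)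
    rw [Ideal.span_le]
    rintro f (rfl | rfl | rfl)
    · exact Ideal.mul_mem_right _ _ h0
    · exact Ideal.mul_mem_right _ _ (Ideal.pow_mem_of_mem _ h1 3 (by norm_num))
    · exact Ideal.mul_mem_right _ _ h0
  · rw [Ideal.height_eq_inf_minimalPrimes]
    refine le_iInf₂ fun Q hQ => ?_
    have hQp : Q.IsPrime := hQ.1.1
    have hle := Ideal.span_le.mp hQ.1.2
    -- Every prime containing the three generators contains two of the variables.
    have key : ∀ i j : Fin 3, i ≠ j → X i ∈ Q → X j ∈ Q → 2 ≤ Q.height := by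
      intro i j hij hi hj
      rw [← hpair i j hij]
      refine Ideal.height_mono (varIdeal_le.mpr ?_)
      rintro l (rfl | rfl)
      · exact hi
      · exact hj
    have h1 := hQp.mem_or_mem (hle (Set.mem_insert _ _))
    have h2 := hQp.mem_or_mem (hle (Set.mem_insert_of_mem _ (Set.mem_insert _ _)))
    have h3 := hQp.mem_or_mem
      (hle (Set.mem_insert_of_mem _ (Set.mem_insert_of_mem _ (Set.mem_singleton _))))
    rw [hQp.pow_mem_iff_mem _ two_pos] at h1
    rw [hQp.pow_mem_iff_mem _ three_pos] at h2
    rw [hQp.pow_mem_iff_mem _ (Nat.pos_of_ne_zero hc)] at h3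
    rcases h2 with h2 | h2
    · rcases h3 with h3 | h3
      · exact key 0 1 (by decide) h3 h2
      · exact key 1 2 (by decide) h2 h3
    · rcases h1 with h1 | h1
      · exact key 0 2 (by decide) h1 h2
      · exact key 1 2 (by decide) h1 h2

end ConvergentPowerSeries

open ConvergentPowerSeries in
theorem mainTheorem7 (x y z : ConvergentPowerSeries 3)
    (hx : x = ConvergentPowerSeries.X 0) (hy : y = ConvergentPowerSeries.X 1)
    (hz : z = ConvergentPowerSeries.X 2) (J₁ J₂ : Ideal (ConvergentPowerSeries 3))
    (hJ₁ : J₁ = Ideal.span {x * y ^ 2, y ^ 3 * z, x * z})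
    (hJ₂ : J₂ = Ideal.span {x * y ^ 2, y ^ 3 * z, x * z ^ 2}) :
    (IsNoetherianRing (ConvergentPowerSeries 3) ∧ ringKrullDim (ConvergentPowerSeries 3) = 3) ∧
    (J₁.height = 2 ∧ J₂.height = 2) ∧
    HasMixedMultiplicity ![J₁, J₁] ![0, 1, 1] 1 ∧
    HasMixedMultiplicity ![J₁, J₂] ![0, 1, 1] 1 ∧
    HasMixedMultiplicity ![J₂, J₂] ![0, 1, 1] 2 ∧
    ¬ AlexandrovFenchelForMixedMultiplicities.{0} := by
  subst hx hy hz
  -- Writing `z` as `z¹` makes `J₁` the case `c = 1` of the family `(xy², y³z, xzᶜ)`.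
  nth_rewrite 2 [← pow_one (ConvergentPowerSeries.X 2)] at hJ₁
  have hht₁ : J₁.height = 2 := hJ₁ ▸ height_span_eq_two one_ne_zero
  have hht₂ : J₂.height = 2 := hJ₂ ▸ height_span_eq_two two_ne_zero
  rw [span_eq_span_idealExponents] at hJ₁ hJ₂
  have hdim : ringKrullDim (ConvergentPowerSeries 3) = 3 := ringKrullDim_eq 3
  have h₁₁ : HasMixedMultiplicity ![J₁, J₁] ![0, 1, 1] 1 := by
    refine hasMixedMultiplicity_of_quadratic _ 1 (1 / 2) 2 2 (1 / 2) (1 / 2) (3 / 2) (3 / 2)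
      (3 / 2) 1 (by norm_num) fun w hw => ?_
    -- Here `a = v₁ + v₂` and `b = 0`, so `v₁v₂` comes from `a²/2`.
    have h := two_mul_mixedHilbertFunction ![J₁, J₁] w (w 0) (w 1 + w 2) 0 (hw 0) (by
      simp [mixedPower, Fin.prod_univ_two, hJ₁, pow_add])
    have h' := congrArg (Nat.cast : ℕ → ℚ) h
    push_cast at h' ⊢
    linarith
  have h₁₂ : HasMixedMultiplicity ![J₁, J₂] ![0, 1, 1] 1 := by
    refine hasMixedMultiplicity_of_quadratic _ 1 (1 / 2) 2 3 (1 / 2) 1 (3 / 2) (3 / 2)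
      1 1 (by norm_num) fun w hw => ?_
    -- Here `v₁v₂` is the term `ab`.
    have h := two_mul_mixedHilbertFunction ![J₁, J₂] w (w 0) (w 1) (w 2) (hw 0) (by
      simp [mixedPower, Fin.prod_univ_two, hJ₁, hJ₂])
    have h' := congrArg (Nat.cast : ℕ → ℚ) h
    push_cast at h' ⊢
    linarith
  have h₂₂ : HasMixedMultiplicity ![J₂, J₂] ![0, 1, 1] 2 := by
    refine hasMixedMultiplicity_of_quadratic _ 2 (1 / 2) 3 3 1 1 (3 / 2) 1 1 1
      (by norm_num) fun w hw => ?_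
    -- Here `b = v₁ + v₂`, and `b²` contributes `2v₁v₂`.
    have h := two_mul_mixedHilbertFunction ![J₂, J₂] w (w 0) 0 (w 1 + w 2) (hw 0) (by
      simp [mixedPower, Fin.prod_univ_two, hJ₂, pow_add])
    have h' := congrArg (Nat.cast : ℕ → ℚ) h
    push_cast at h' ⊢
    linarith
  refine ⟨⟨inferInstance, hdim⟩, ⟨hht₁, hht₂⟩, h₁₁, h₁₂, h₂₂, fun hAF => ?_⟩
  have hidx : (Fin.cons 0 fun _ => 1 : Fin 3 → ℕ) = ![0, 1, 1] := by
    ext i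
    fin_cases i <;> rfl
  -- With `n = 2` there are no further ideals, and the inequality would read `1 · 2 ≤ 1²`.
  have h := hAF 0 (ConvergentPowerSeries 3) hdim J₁ J₂ ![] hht₁ hht₂ (fun j => j.elim0) 1 1 2
    (by rw [hidx]; exact h₁₁) (by rw [hidx]; exact h₁₂) (by rw [hidx]; exact h₂₂)
  norm_num at h
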